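/- For a finite simple graph $G=(V,E)$, a minus-domination function is a function $f:V\to\{-1,0,1\}$ such that $\sum_{y\in N[x]} f(y)>0$ for every vertex $x$, where $N[x]=\{x\}\cup N(x)$; the minus-domination number $\gamma^-(G)$ is the minimum of $\sum_{x\in V} f(x)$ over all minus-domination functions $f$ of $G$. A graph is distance-hereditary if, for every pair of nonadjacent vertices, all chordless paths between them have the same length. Theorem. There exists a polynomial-time algorithm that computes $\gamma^-$ for distance-hereditary graphs. That is, there are a program for a random access machine (unit cost per elementary operation, with addition, subtraction and comparison of integers as the arithmetic operations) and a polynomial $T$ such that, for every $n \ge 0$ and every distance-hereditary graph $G$ with $n$ vertices, the program, given $n$ and the adjacency matrix of $G$, halts after at most $T(n)$ steps with output $\gamma^-(G)$. -/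

import Mathlib

namespace MinusDomination

/-! ### Minus domination -/

section Graph

variable {V : Type*}

open Classical in
/-- The value `f(N[x])`, the sum of `f` over the closed neighbourhood of `x`. -/
noncomputable def closedNbhdSum [Fintype V] (G : SimpleGraph V) (f : V → ℤ) (x : V) : ℤ :=
  ∑ y ∈ Finset.univ.filter (fun y => y = x ∨ G.Adj x y), f y

/-- `f : V → {-1, 0, 1}` is a minus-domination function if `f(N[x]) > 0` for all `x`. -/
def IsMinusDomination [Fintype V] (G : SimpleGraph V) (f : V → ℤ) : Prop :=
  (∀ x, f x = -1 ∨ f x = 0 ∨ f x = 1) ∧ ∀ x, 0 < closedNbhdSum G f x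

/-- The set of weights `f(V)` of the minus-domination functions of `G`. -/
def minusDominationWeights [Fintype V] (G : SimpleGraph V) : Set ℤ :=
  {w | ∃ f : V → ℤ, IsMinusDomination G f ∧ w = ∑ x, f x}

/-- The minus-domination number, the minimum weight of a minus-domination function.
The minimum is attained, see `isLeast_minusDominationNumber`. -/
noncomputable def minusDominationNumber [Fintype V] (G : SimpleGraph V) : ℤ :=
  sInf (minusDominationWeights G)

theorem isLeast_minusDominationNumber [Fintype V] (G : SimpleGraph V) :
    IsLeast (minusDominationWeights G) (minusDominationNumber G) := by
  have hne : (minusDominationWeights G).Nonempty := by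
    refine ⟨_, fun _ => 1, ⟨fun _ => Or.inr (Or.inr rfl), fun x => ?_⟩, rfl⟩
    unfold closedNbhdSum
    exact Finset.sum_pos (fun _ _ => one_pos) ⟨x, by simp⟩
  have hbd : BddBelow (minusDominationWeights G) := by
    refine ⟨∑ _x : V, (-1 : ℤ), ?_⟩
    rintro w ⟨f, hf, rfl⟩
    refine Finset.sum_le_sum fun x _ => ?_
    rcases hf.1 x with h | h | h <;> omega
  exact ⟨Int.csInf_mem hne hbd, fun w hw => csInf_le hbd hw⟩

/-! ### Distance-hereditary graphs -/

/-- A graph is distance-hereditary if, for every pair of nonadjacent vertices, all the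
chordless paths between them have the same length. -/
def IsDistanceHereditary (G : SimpleGraph V) : Prop :=
  ∀ u v : V, ¬ G.Adj u v → ∀ p q : G.Walk u v,
    p.IsPath → p.IsChordless → q.IsPath → q.IsChordless → p.length = q.length

end Graph

/-! ### A random access machine

Programs are while-programs over integer variables and integer arrays.  The arithmetic
operations are addition and subtraction only, so that numbers of length exponential in the
running time cannot be built, and counting every elementary operation as one step gives a model
that is equivalent to Turing machines up to polynomial factors in the running time. -/

/-- A memory: `m x [k₁, …, k_r]` is the integer in the cell with indices `k₁, …, k_r` of the
array named `x`.  The cell `m x []` is the scalar variable `x`. -/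
abbrev Memory : Type := ℕ → List ℤ → ℤ

/-- The address list denoted by a list of scalar variables: their current values. -/
def Memory.address (m : Memory) (idx : List ℕ) : List ℤ := idx.map fun i => m i []

/-- Overwrite one memory cell. -/
def Memory.write (m : Memory) (x : ℕ) (a : List ℤ) (z : ℤ) : Memory :=
  fun y b => if y = x ∧ b = a then z else m y b

/-- Integer expressions; `cell x [i₁, …, i_r]` is `x[i₁, …, i_r]`, where `i₁, …, i_r` are scalar
variables, and in particular `cell x []` is the scalar variable `x`. -/
inductive Expr : Type
  | const (z : ℤ) : Expr
  | cell (x : ℕ) (idx : List ℕ) : Expr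
  | add (e₁ e₂ : Expr) : Expr
  | sub (e₁ e₂ : Expr) : Expr

/-- The value of an expression. -/
def Expr.eval (m : Memory) : Expr → ℤ
  | .const z => z
  | .cell x idx => m x (m.address idx)
  | .add e₁ e₂ => e₁.eval m + e₂.eval m
  | .sub e₁ e₂ => e₁.eval m - e₂.eval m

/-- The number of elementary operations that the evaluation of an expression takes. -/
def Expr.cost : Expr → ℕ
  | .const _ => 1
  | .cell _ idx => 1 + idx.length
  | .add e₁ e₂ => 1 + e₁.cost + e₂.cost
  | .sub e₁ e₂ => 1 + e₁.cost + e₂.cost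

/-- Tests: comparisons of integer expressions and their Boolean combinations. -/
inductive Test : Type
  | le (e₁ e₂ : Expr) : Test
  | not (b : Test) : Test
  | and (b₁ b₂ : Test) : Test

/-- When a test succeeds. -/
def Test.Holds (m : Memory) : Test → Prop
  | .le e₁ e₂ => e₁.eval m ≤ e₂.eval m
  | .not b => ¬ b.Holds m
  | .and b₁ b₂ => b₁.Holds m ∧ b₂.Holds m

/-- The number of elementary operations that a test takes. -/
def Test.cost : Test → ℕ
  | .le e₁ e₂ => 1 + e₁.cost + e₂.cost
  | .not b => 1 + b.cost
  | .and b₁ b₂ => 1 + b₁.cost + b₂.cost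

/-- Programs. -/
inductive Program : Type
  | skip : Program
  /-- The assignment `x[idx] := e`. -/
  | assign (x : ℕ) (idx : List ℕ) (e : Expr) : Program
  /-- Sequential composition. -/
  | seq (p q : Program) : Program
  /-- If the test succeeds do `p`, else do `q`. -/
  | branch (b : Test) (p q : Program) : Program
  /-- While the test succeeds do `p`. -/
  | loop (b : Test) (p : Program) : Program

/-- `Runs p m m' t`: the program `p`, started with memory `m`, halts with memory `m'` after
exactly `t` elementary steps. -/
inductive Runs : Program → Memory → Memory → ℕ → Prop
  | skip (m : Memory) : Runs .skip m m 1
  | assign (x : ℕ) (idx : List ℕ) (e : Expr) (m : Memory) :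
      Runs (.assign x idx e) m (m.write x (m.address idx) (e.eval m)) (1 + idx.length + e.cost)
  | seq {p q : Program} {m m₁ m₂ : Memory} {t₁ t₂ : ℕ} :
      Runs p m m₁ t₁ → Runs q m₁ m₂ t₂ → Runs (.seq p q) m m₂ (t₁ + t₂)
  | branch_pos {b : Test} {p q : Program} {m m₁ : Memory} {t : ℕ} :
      b.Holds m → Runs p m m₁ t → Runs (.branch b p q) m m₁ (1 + b.cost + t)
  | branch_neg {b : Test} {p q : Program} {m m₁ : Memory} {t : ℕ} :
      ¬ b.Holds m → Runs q m m₁ t → Runs (.branch b p q) m m₁ (1 + b.cost + t)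
  | loop_done {b : Test} {p : Program} {m : Memory} :
      ¬ b.Holds m → Runs (.loop b p) m m (1 + b.cost)
  | loop_step {b : Test} {p : Program} {m m₁ m₂ : Memory} {t₁ t₂ : ℕ} :
      b.Holds m → Runs p m m₁ t₁ → Runs (.loop b p) m₁ m₂ t₂ →
      Runs (.loop b p) m m₂ (1 + b.cost + t₁ + t₂)

/-- The machine is deterministic. -/
theorem Runs.deterministic {p : Program} {m m₁ m₂ : Memory} {t₁ t₂ : ℕ}
    (h₁ : Runs p m m₁ t₁) (h₂ : Runs p m m₂ t₂) : m₁ = m₂ ∧ t₁ = t₂ := by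
  induction h₁ generalizing m₂ t₂ with
  | skip m => cases h₂; exact ⟨rfl, rfl⟩
  | assign x idx e m => cases h₂; exact ⟨rfl, rfl⟩
  | seq _ _ ih₁ ih₂ =>
    cases h₂ with
    | seq a b =>
      obtain ⟨rfl, rfl⟩ := ih₁ a
      obtain ⟨rfl, rfl⟩ := ih₂ b
      exact ⟨rfl, rfl⟩
  | branch_pos hb _ ih =>
    cases h₂ with
    | branch_pos _ a => obtain ⟨rfl, rfl⟩ := ih a; exact ⟨rfl, rfl⟩
    | branch_neg hb' _ => exact absurd hb hb'
  | branch_neg hb _ ih =>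
    cases h₂ with
    | branch_pos hb' _ => exact absurd hb' hb
    | branch_neg _ a => obtain ⟨rfl, rfl⟩ := ih a; exact ⟨rfl, rfl⟩
  | loop_done hb =>
    cases h₂ with
    | loop_done _ => exact ⟨rfl, rfl⟩
    | loop_step hb' _ _ => exact absurd hb' hb
  | loop_step hb _ _ ih₁ ih₂ =>
    cases h₂ with
    | loop_done hb' => exact absurd hb hb'
    | loop_step _ a b =>
      obtain ⟨rfl, rfl⟩ := ih₁ a
      obtain ⟨rfl, rfl⟩ := ih₂ b
      exact ⟨rfl, rfl⟩

open Classical in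
/-- The initial memory for a graph with vertices `0, …, n - 1`: the scalar variable `0` holds
`n`, the array `1` holds the adjacency matrix, and all the other cells are zero. -/
noncomputable def graphInput {n : ℕ} (G : SimpleGraph (Fin n)) : Memory :=
  fun x a =>
    if x = 0 ∧ a = [] then (n : ℤ)
    else if x = 1 ∧ ∃ i j : Fin n, G.Adj i j ∧ a = [((i : ℕ) : ℤ), ((j : ℕ) : ℤ)] then 1
    else 0

/-- The output of a computation is the final value of the scalar variable `2`. -/
def output (m : Memory) : ℤ := m 2 []

/-- The program `p` computes the integer graph parameter `φ` on the graphs in the class `C` in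
polynomial time: there is a polynomial `T` such that for every graph in `C` with `n` vertices, given
by its adjacency matrix, `p` halts within `T(n)` steps with the value of `φ` as output. -/
def ComputesInPolyTime (p : Program) (C : ∀ {n : ℕ}, SimpleGraph (Fin n) → Prop)
    (φ : ∀ {n : ℕ}, SimpleGraph (Fin n) → ℤ) : Prop :=
  ∃ T : Polynomial ℕ, ∀ (n : ℕ) (G : SimpleGraph (Fin n)), C G →
    ∃ (m : Memory) (t : ℕ), Runs p (graphInput G) m t ∧ t ≤ T.eval n ∧ output m = φ G

end MinusDomination

namespace MinusDomination

/-! ### Distance-hereditary graphs: chordless paths and distances in induced subgraphs -/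

section Structure

variable {V : Type*} {G : SimpleGraph V}

open SimpleGraph

/-! In a distance-hereditary graph, every set of at least two vertices contains distinct `u`, `v`
such that, within the set, `u` and `v` are twins or `v` has no neighbour except possibly `u`
(`IsDistanceHereditary.exists_isRemovable_induce`). Such a pair is found in the last distance level
from a root, or among the neighbours of a vertex there; vertices with a common neighbour induce a
cograph, and cographs have twins. So the graph can be consumed by merging `v` into `u` again and
again, and any mergeable pair will do.

During the process each remaining vertex stands for a cluster of original vertices. Some of them are
visible, with the same neighbours outside the cluster; the others have none there. The outside
matters only through three integers: the sum `s` of `f` over the visible vertices, the sum `d` that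
each visible vertex receives from outside, and the weight `w` of the cluster. A table lists the
admissible triples. Let `a` be the adjacency entry of `u` and `v`, and let `b` be `1` for twins and
`0` otherwise. A merge then gives `s = s₁ + b * s₂` and `w = w₁ + w₂`; the visible part of `u`
receives `d + a * s₂`, that of `v` receives `b * d + a * s₁`. By `Represents.merge` the set of
attainable total weights stays the same. A last single vertex receives nothing, so the least `w` in
its table with `d = 0` is the answer.

Since `|s|` and `|w|` are at most the size of the cluster, all loops can run over `-n, …, n`. The
algorithm is written with such loops only, so its time bound can be read off the syntax
(`Cmd.runs_compile`), and correctness concerns only the function that it denotes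
(`Invariant.denote_mainLoop`, `Invariant.output_findMinimum`). -/

theorem isChordless_of_length_le {u v : V} (p : G.Walk u v)
    (hp : ∀ q : G.Walk u v, p.length ≤ q.length) : p.IsChordless := by
  classical
  rw [Walk.isChordless_iff_forall_mem_edges]
  induction p with
  | nil => simp +contextual
  | @cons a b c h p ih =>
    have ih' := ih fun q => by simpa using hp (q.cons h)
    have key : ∀ y, y ∈ p.support → G.Adj a y → s(a, y) ∈ (Walk.cons h p).edges := by
      intro y hy hay
      by_cases hby : y = b
      · subst hby; simp
      · exfalso
        have h1 := hp ((p.dropUntil y hy).cons hay)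
        have h2 := congrArg Walk.length (p.take_spec hy)
        have h3 : (p.takeUntil y hy).length ≠ 0 := fun h0 =>
          hby (Walk.eq_of_length_eq_zero h0).symm
        simp only [Walk.length_cons, Walk.length_append] at h1 h2
        omega
    intro x y hx hy hxy
    rw [Walk.support_cons, List.mem_cons] at hx hy
    rcases hx with rfl | hx
    · rcases hy with rfl | hy
      · exact absurd hxy (G.loopless.irrefl _)
      · exact key y hy hxy
    · rcases hy with rfl | hy
      · rw [Sym2.eq_swap]; exact key x hx hxy.symm
      · rw [Walk.edges_cons]; exact List.mem_cons_of_mem _ (ih' hx hy hxy)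

theorem isChordless_map_induce {U : Set V} {u v : U} {p : (G.induce U).Walk u v}
    (hp : p.IsChordless) : (p.map (Embedding.induce U).toHom).IsChordless := by
  rw [Walk.isChordless_iff_forall_mem_edges] at hp ⊢
  intro x y hx hy hxy
  rw [Walk.support_map, List.mem_map] at hx hy
  obtain ⟨x, hx, rfl⟩ := hx
  obtain ⟨y, hy, rfl⟩ := hy
  rw [Walk.edges_map, List.mem_map]
  exact ⟨s(x, y), hp hx hy hxy, rfl⟩

theorem isPath_map_induce {U : Set V} {u v : U} {p : (G.induce U).Walk u v}
    (hp : p.IsPath) : (p.map (Embedding.induce U).toHom).IsPath :=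
  hp.map Subtype.val_injective

theorem IsDistanceHereditary.induce (hG : IsDistanceHereditary G) (U : Set V) :
    IsDistanceHereditary (G.induce U) := by
  intro u v huv p q hp hp' hq hq'
  have := hG u v huv _ _ (isPath_map_induce hp) (isChordless_map_induce hp')
    (isPath_map_induce hq) (isChordless_map_induce hq')
  exact (Walk.length_map _ _).symm.trans (this.trans (Walk.length_map _ _))

/-- A shortest walk in the subgraph and one in `G` are both chordless paths of `G` with the same
ends, hence equally long when the ends are nonadjacent. This is the main form in which the
hypothesis is used. -/
theorem IsDistanceHereditary.dist_induce (hG : IsDistanceHereditary G) {U : Set V} {u v : U}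
    (h : (G.induce U).Reachable u v) : (G.induce U).dist u v = G.dist u v := by
  by_cases huv : G.Adj u v
  · rw [dist_eq_one_iff_adj.2 huv, dist_eq_one_iff_adj.2 (show (G.induce U).Adj u v from huv)]
  · obtain ⟨p, hp⟩ := h.exists_walk_length_eq_dist
    obtain ⟨q, hq⟩ := (h.map (Embedding.induce U).toHom).exists_walk_length_eq_dist
    have hp' := isChordless_of_length_le p fun r => hp ▸ dist_le r
    have hq' := isChordless_of_length_le q fun r => hq ▸ dist_le r
    have := hG u v huv _ q (isPath_map_induce (p.isPath_of_length_eq_dist hp))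
      (isChordless_map_induce hp') (q.isPath_of_length_eq_dist hq) hq'
    exact hp.symm.trans ((Walk.length_map _ _).symm.trans (this.trans hq))

/-- Two vertices with a common neighbour that are joined by a path within `U` have a common
neighbour in `U`. -/
theorem IsDistanceHereditary.exists_common_nbr (hG : IsDistanceHereditary G) {U : Set V} {u v : U}
    (h : (G.induce U).Reachable u v) (hne : u ≠ v) (hadj : ¬ G.Adj u v) {a : V} (hua : G.Adj u a)
    (hav : G.Adj a v) : ∃ t ∈ U, G.Adj u t ∧ G.Adj t v := by
  have h1 := hG.dist_induce h
  have h2 : G.dist (u : V) v ≤ 2 := dist_le (Walk.cons hua (Walk.cons hav Walk.nil))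
  obtain ⟨p, hp⟩ := h.exists_walk_length_eq_dist
  cases p with
  | nil => exact absurd rfl hne
  | @cons _ b _ h3 p =>
    cases p with
    | nil => exact absurd h3 hadj
    | @cons _ c _ h4 p =>
      simp only [Walk.length_cons] at hp
      obtain rfl := Walk.eq_of_length_eq_zero (p := p) (by omega)
      exact ⟨b, b.2, h3, h4⟩

theorem reachable_induce_of_adj {U : Set V} {x y : V} (hx : x ∈ U) (hy : y ∈ U) (h : G.Adj x y) :
    (G.induce U).Reachable ⟨x, hx⟩ ⟨y, hy⟩ :=
  Adj.reachable (show (G.induce U).Adj ⟨x, hx⟩ ⟨y, hy⟩ from h)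

/-! ### Cographs and their twins -/

/-- `G` has no induced path on four vertices within `C`. -/
def IsCographOn (G : SimpleGraph V) (C : Finset V) : Prop :=
  ∀ x ∈ C, ∀ y ∈ C, ∀ z ∈ C, ∀ w ∈ C, G.Adj x y → G.Adj y z → G.Adj z w → x ≠ z → y ≠ w → x ≠ w →
    G.Adj x z ∨ G.Adj y w ∨ G.Adj x w

/-- The ends of an induced path on four vertices would have the common neighbour `t`, but none on
the path itself. -/
theorem IsDistanceHereditary.isCographOn (hG : IsDistanceHereditary G) {C : Finset V} {t : V}
    (ht : ∀ x ∈ C, G.Adj t x) : IsCographOn G C := by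
  intro x hx y hy z hz w hw hxy hyz hzw _ _ hxw
  by_contra! hcon
  obtain ⟨h1, h2, h3⟩ := hcon
  let U : Set V := {x, y, z, w}
  have mx : x ∈ U := by simp [U]
  have my : y ∈ U := by simp [U]
  have mz : z ∈ U := by simp [U]
  have mw : w ∈ U := by simp [U]
  obtain ⟨s, hs, hs1, hs2⟩ := hG.exists_common_nbr (u := ⟨x, mx⟩) (v := ⟨w, mw⟩)
    ((reachable_induce_of_adj mx my hxy).trans ((reachable_induce_of_adj my mz hyz).trans
      (reachable_induce_of_adj mz mw hzw))) (by simpa using hxw) h3 (ht x hx).symm (ht w hw)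
  rcases hs with rfl | rfl | rfl | rfl
  · exact G.loopless.irrefl _ hs1
  · exact h2 hs2
  · exact h1 hs1
  · exact G.loopless.irrefl _ hs2

theorem IsCographOn.mono {C D : Finset V} (h : IsCographOn G C) (hD : D ⊆ C) : IsCographOn G D :=
  fun x hx y hy z hz w hw => h x (hD hx) y (hD hy) z (hD hz) w (hD hw)

/-- The path on four vertices is self-complementary: `x, y, z, w` in `Gᶜ` becomes `y, w, x, z` in
`G`. -/
theorem IsCographOn.compl {C : Finset V} (h : IsCographOn G C) : IsCographOn Gᶜ C := by
  intro x hx y hy z hz w hw hxy hyz hzw hxz hyw hxw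
  simp only [compl_adj] at *
  by_contra! hcon
  obtain ⟨h1, h2, h3⟩ := hcon
  have := h y hy w hw x hx z hz (h2 hyw) (h3 hxw).symm (h1 hxz) hxy.1.symm (Ne.symm hzw.1) hyz.1
  rcases this with h | h | h
  · exact hxy.2 h.symm
  · exact hzw.2 h.symm
  · exact hyz.2 h

/-- `A` is a proper nonempty part of `C` that is joined by no edge to the rest of `C`. -/
def IsSeparatedPart (G : SimpleGraph V) (C A : Finset V) : Prop :=
  A ⊆ C ∧ A.Nonempty ∧ (∃ b ∈ C, b ∉ A) ∧ ∀ a ∈ A, ∀ b ∈ C, b ∉ A → ¬ G.Adj a b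

/-- If `x` misses one of the two sides, the enlarged set is still disconnected; if `x` sees
everything, it is isolated in the complement. Otherwise the nonneighbours of `x` on one side are cut
off: an edge from such a `y` to a neighbour `z` of `x` on that side would give an induced path `d,
x, z, y` with `d` a neighbour of `x` on the other side. -/
theorem IsSeparatedPart.exists_insert [DecidableEq V] {C A : Finset V} {x : V} (hx : x ∉ C)
    (hC : IsCographOn G (insert x C)) (hA : IsSeparatedPart G C A) :
    ∃ A', IsSeparatedPart G (insert x C) A' ∨ IsSeparatedPart Gᶜ (insert x C) A' := by
  classical
  obtain ⟨hAC, hne, ⟨b, hb, hbA⟩, hsep⟩ := hA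
  have key : ∀ A B : Finset V, A ⊆ C → B ⊆ C → (∀ a ∈ A, ∀ b ∈ B, ¬ G.Adj a b) → Disjoint A B →
      A ∪ B = C → (∃ b ∈ B, G.Adj x b) → (∃ a ∈ A, ¬ G.Adj x a) →
      ∃ A', IsSeparatedPart G (insert x C) A' ∨ IsSeparatedPart Gᶜ (insert x C) A' := by
    rintro A B hAC hBC hAB hdis hun ⟨d, hd, hxd⟩ ⟨a, ha, hxa⟩
    refine ⟨A.filter fun y => ¬ G.Adj x y, Or.inl ⟨fun y hy => ?_, ⟨a, by simp [ha, hxa]⟩,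
      ⟨d, Finset.mem_insert_of_mem (hBC hd), by simp [hxd]⟩, ?_⟩⟩
    · exact Finset.mem_insert_of_mem (hAC (Finset.mem_filter.1 hy).1)
    · intro y hy z hz hz' hyz
      rw [Finset.mem_filter] at hy hz'
      rw [Finset.mem_insert] at hz
      rcases hz with rfl | hz
      · exact hy.2 hyz.symm
      · rw [← hun, Finset.mem_union] at hz
        rcases hz with hz | hz
        · have hxz : G.Adj x z := by by_contra h; exact hz' ⟨hz, h⟩
          have hyC := hAC hy.1
          have hzC := hAC hz
          have := hC d (by simp [hBC hd]) x (by simp) z (by simp [hzC]) y (by simp [hyC])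
            hxd.symm hxz hyz.symm
            (fun h => Finset.disjoint_left.1 hdis hz (h ▸ hd)) (fun h => hx (h ▸ hyC))
            (fun h => Finset.disjoint_left.1 hdis hy.1 (h ▸ hd))
          rcases this with h | h | h
          · exact hAB z hz d hd h.symm
          · exact hy.2 h
          · exact hAB y hy.1 d hd h.symm
        · exact hAB y hy.1 z hz hyz
  by_cases h1 : ∃ a ∈ A, G.Adj x a
  · by_cases h2 : ∃ b ∈ C \ A, G.Adj x b
    · by_cases h3 : ∃ a ∈ A, ¬ G.Adj x a
      · exact key A (C \ A) hAC Finset.sdiff_subset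
          (fun a ha b hb => hsep a ha b (Finset.mem_sdiff.1 hb).1 (Finset.mem_sdiff.1 hb).2)
          Finset.disjoint_sdiff (Finset.union_sdiff_of_subset hAC) h2 h3
      · by_cases h4 : ∃ b ∈ C \ A, ¬ G.Adj x b
        · exact key (C \ A) A Finset.sdiff_subset hAC
            (fun b hb a ha h => hsep a ha b (Finset.mem_sdiff.1 hb).1 (Finset.mem_sdiff.1 hb).2
              h.symm) Finset.sdiff_disjoint (Finset.sdiff_union_of_subset hAC) h1 h4
        · push Not at h3 h4
          refine ⟨{x}, Or.inr ⟨by simp, by simp, ⟨b, by simp [hb], ?_⟩, ?_⟩⟩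
          · rintro h; exact hx (Finset.mem_singleton.1 h ▸ hb)
          · intro a ha c hc hc'
            obtain rfl := Finset.mem_singleton.1 ha
            have hcC : c ∈ C := (Finset.mem_insert.1 hc).resolve_left fun h => hc' (by simp [h])
            rw [compl_adj]
            rintro ⟨_, h⟩
            by_cases hcA : c ∈ A
            · exact h (h3 c hcA)
            · exact h (h4 c (by simp [hcC, hcA]))
    · push Not at h2
      refine ⟨insert x A, Or.inl ⟨Finset.insert_subset_insert _ hAC, by simp, ⟨b, by simp [hb], ?_⟩,
        ?_⟩⟩
      · rw [Finset.mem_insert]; rintro (rfl | h)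
        exacts [hx hb, hbA h]
      · intro a ha c hc hc'
        rw [Finset.mem_insert, not_or] at hc'
        have hcC := (Finset.mem_insert.1 hc).resolve_left hc'.1
        rcases Finset.mem_insert.1 ha with rfl | ha
        · exact h2 c (by simp [hcC, hc'.2])
        · exact hsep a ha c hcC hc'.2
  · push Not at h1
    refine ⟨A, Or.inl ⟨hAC.trans (Finset.subset_insert _ _), hne, ⟨b, by simp [hb], hbA⟩, ?_⟩⟩
    intro a ha c hc hc'
    rcases Finset.mem_insert.1 hc with rfl | hc
    · exact fun h => h1 a ha h.symm
    · exact hsep a ha c hc hc'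

/-- Vertices are added one at a time; as cographs are closed under complement, the insertion lemma
for `Gᶜ` settles the complementary case. -/
theorem IsCographOn.exists_isSeparatedPart [DecidableEq V] {C : Finset V} (hC : IsCographOn G C)
    (h2 : 2 ≤ C.card) : ∃ A, IsSeparatedPart G C A ∨ IsSeparatedPart Gᶜ C A := by
  induction C using Finset.induction_on with
  | empty => simp at h2
  | @insert x C hx ih =>
    rw [Finset.card_insert_of_notMem hx] at h2
    by_cases h1 : C.card = 1
    · obtain ⟨y, rfl⟩ := Finset.card_eq_one.1 h1
      have hxy : x ≠ y := by simpa using hx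
      by_cases hadj : G.Adj x y
      · refine ⟨{x}, Or.inr ⟨by simp, by simp, ⟨y, by simp [hxy.symm]⟩, ?_⟩⟩
        simp_all
      · refine ⟨{x}, Or.inl ⟨by simp, by simp, ⟨y, by simp [hxy.symm]⟩, ?_⟩⟩
        simp_all
    · obtain ⟨A, hA | hA⟩ := ih (hC.mono (Finset.subset_insert _ _)) (by omega)
      · exact hA.exists_insert hx hC
      · obtain ⟨A', h⟩ := hA.exists_insert hx hC.compl
        rw [compl_compl] at h
        exact ⟨A', h.symm⟩

/-- Between a separated part and the rest of `C` there are all edges or none, so twins within either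
side are twins in `C`. If neither side has two vertices, `C` is a pair. -/
theorem IsCographOn.exists_twins [DecidableEq V] {C : Finset V} (hC : IsCographOn G C)
    (h2 : 2 ≤ C.card) :
    ∃ u ∈ C, ∃ v ∈ C, u ≠ v ∧ ∀ x ∈ C, x ≠ u → x ≠ v → (G.Adj x u ↔ G.Adj x v) := by
  induction C using Finset.strongInduction with
  | H C ih =>
    have key : ∀ D ⊂ C, 2 ≤ D.card → (∀ x ∈ C, x ∉ D → ∀ u ∈ D, ∀ v ∈ D, (G.Adj x u ↔ G.Adj x v)) →
        ∃ u ∈ C, ∃ v ∈ C, u ≠ v ∧ ∀ x ∈ C, x ≠ u → x ≠ v → (G.Adj x u ↔ G.Adj x v) := by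
      intro D hD hD2 hmod
      obtain ⟨u, hu, v, hv, huv, h⟩ := ih D hD (hC.mono hD.1) hD2
      refine ⟨u, hD.1 hu, v, hD.1 hv, huv, fun x hx => ?_⟩
      by_cases hxD : x ∈ D
      · exact h x hxD
      · exact fun _ _ => hmod x hx hxD u hu v hv
    obtain ⟨A, hA⟩ := hC.exists_isSeparatedPart h2
    have hA' : A ⊆ C ∧ A.Nonempty ∧ (∃ b ∈ C, b ∉ A) ∧
        ∀ a ∈ A, ∀ b ∈ C, b ∉ A → ∀ a' ∈ A, ∀ b' ∈ C, b' ∉ A → (G.Adj a b ↔ G.Adj a' b') := by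
      rcases hA with ⟨h1, h2, h3, h4⟩ | ⟨h1, h2, h3, h4⟩
      · exact ⟨h1, h2, h3, fun a ha b hb hb' a' ha' b' hb1 hb2 =>
          iff_of_false (h4 a ha b hb hb') (h4 a' ha' b' hb1 hb2)⟩
      · have : ∀ a ∈ A, ∀ b ∈ C, b ∉ A → G.Adj a b := fun a ha b hb hb' => by
          by_contra h
          exact h4 a ha b hb hb' ((compl_adj _ _ _).2 ⟨fun h => hb' (h ▸ ha), h⟩)
        exact ⟨h1, h2, h3, fun a ha b hb hb' a' ha' b' hb1 hb2 =>
          iff_of_true (this a ha b hb hb') (this a' ha' b' hb1 hb2)⟩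
    obtain ⟨hAC, ⟨a, ha⟩, ⟨b, hb, hbA⟩, hmod⟩ := hA'
    have hss : A ⊂ C := ⟨hAC, fun h => hbA (h hb)⟩
    have hcard := Finset.card_sdiff_add_card_eq_card hAC
    by_cases hA2 : 2 ≤ A.card
    · exact key A hss hA2 fun x hx hxA u hu v hv => by
        rw [G.adj_comm x u, G.adj_comm x v]; exact hmod u hu x hx hxA v hv x hx hxA
    · by_cases hB2 : 2 ≤ (C \ A).card
      · refine key (C \ A) (Finset.sdiff_ssubset hAC ⟨a, ha⟩) hB2 fun x hx hxA u hu v hv => ?_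
        simp only [Finset.mem_sdiff, not_and, not_not] at hxA hu hv
        exact hmod x (hxA hx) u hu.1 hu.2 x (hxA hx) v hv.1 hv.2
      · have hA1 : A.card ≤ 1 := by omega
        have hB1 : (C \ A).card ≤ 1 := by omega
        refine ⟨a, hAC ha, b, hb, fun h => hbA (h ▸ ha), fun x hx hxa hxb => ?_⟩
        exfalso
        by_cases hxA : x ∈ A
        · exact hxa (Finset.card_le_one.1 hA1 x hxA a ha)
        · exact hxb (Finset.card_le_one.1 hB1 x (by simp [hx, hxA]) b (by simp [hb, hbA]))

/-! ### Distance levels, and a removable vertex in the last level or just below it -/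

/-- `x` has distance `k` from `r`. -/
def AtLevel (G : SimpleGraph V) (r x : V) (k : ℕ) : Prop :=
  G.Reachable x r ∧ G.dist x r = k

theorem AtLevel.eq {r x : V} {j k : ℕ} (h : AtLevel G r x j) (h' : AtLevel G r x k) : j = k :=
  h.2.symm.trans h'.2

theorem AtLevel.eq_root {r x : V} (h : AtLevel G r x 0) : x = r :=
  h.1.dist_eq_zero_iff.1 h.2

theorem AtLevel.exists_lower {r x : V} {k : ℕ} (h : AtLevel G r x (k + 1)) :
    ∃ z, G.Adj x z ∧ AtLevel G r z k := by
  obtain ⟨p, hp⟩ := h.1.exists_walk_length_eq_dist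
  rw [h.2] at hp
  cases p with
  | nil => simp at hp
  | @cons _ z _ hxz p =>
    refine ⟨z, hxz, p.reachable, le_antisymm ?_ ?_⟩
    · have := dist_le p
      rw [Walk.length_cons] at hp; omega
    · obtain ⟨q, hq⟩ := p.reachable.exists_walk_length_eq_dist
      have := dist_le (Walk.cons hxz q)
      rw [Walk.length_cons, h.2] at this; omega

theorem AtLevel.exists_of_adj {r x y : V} {k : ℕ} (h : AtLevel G r x k) (hxy : G.Adj x y) :
    ∃ j, AtLevel G r y j ∧ j ≤ k + 1 ∧ k ≤ j + 1 := by
  have hy : G.Reachable y r := hxy.symm.reachable.trans h.1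
  refine ⟨_, ⟨hy, rfl⟩, ?_, ?_⟩
  · obtain ⟨q, hq⟩ := h.1.exists_walk_length_eq_dist
    have := dist_le (Walk.cons hxy.symm q)
    rw [Walk.length_cons, hq, h.2] at this; omega
  · obtain ⟨q, hq⟩ := hy.exists_walk_length_eq_dist
    have := dist_le (Walk.cons hxy q)
    rw [Walk.length_cons, hq, h.2] at this; omega

/-- `U` keeps only `z` from level `k`. Through `x` and `z`, the vertex `y` still reaches `r` within
`U`, so its distance remains `k + 1`; a shortest walk must then step from `y` directly into level
`k`, that is, to `z`. -/
theorem IsDistanceHereditary.adj_of_reachable (hG : IsDistanceHereditary G) {r x y z : V} {k : ℕ}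
    (hy : AtLevel G r y (k + 1)) (hz : AtLevel G r z k) (hxz : G.Adj x z)
    {U : Set V} (hU : U = {w | AtLevel G r w k → w = z}) (hyU : y ∈ U) (hxU : x ∈ U)
    (h : (G.induce U).Reachable ⟨y, hyU⟩ ⟨x, hxU⟩) : G.Adj y z := by
  have hzU : z ∈ U := by simp [hU]
  have hrU : r ∈ U := by
    rw [hU]
    intro hr
    obtain rfl := hr.eq ⟨.rfl, dist_self⟩
    exact hz.eq_root.symm
  have down : ∀ j ≤ k, ∀ w (hw : w ∈ U), AtLevel G r w j →
      (G.induce U).Reachable ⟨w, hw⟩ ⟨r, hrU⟩ := by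
    intro j
    induction j with
    | zero =>
      intro _ w hw h
      obtain rfl := h.eq_root
      exact .rfl
    | succ j ih =>
      intro hj w hw h
      obtain ⟨w', hww', hw'⟩ := h.exists_lower
      have hw'U : w' ∈ U := by
        rw [hU]; intro h'; have := h'.eq hw'; omega
      exact (reachable_induce_of_adj hw hw'U hww').trans (ih (by omega) w' hw'U hw')
  have hreach := (h.trans (reachable_induce_of_adj hxU hzU hxz)).trans (down k le_rfl z hzU hz)
  have hdist := hG.dist_induce hreach
  obtain ⟨p, hp⟩ := hreach.exists_walk_length_eq_dist
  rw [hdist, show G.dist _ _ = k + 1 from hy.2] at hp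
  cases p with
  | nil => simp at hp
  | @cons _ w _ hyw p =>
    rw [Walk.length_cons] at hp
    have hwr := dist_le (p.map (Embedding.induce U).toHom)
    rw [show (p.map (Embedding.induce U).toHom).length = p.length from Walk.length_map _ _] at hwr
    replace hwr : G.dist w r ≤ k := hwr.trans (by omega)
    replace hyw : G.Adj y w := hyw
    obtain ⟨j, hj, _, hj2⟩ := hy.exists_of_adj hyw
    rw [hj.2] at hwr
    obtain rfl : j = k := by omega
    have hwz : (w : V) = z := hU.le w.2 hj
    exact hwz ▸ hyw

/-- Vertices of a level that are adjacent, or that have a common neighbour in the next level, have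
the same neighbours in the previous level. -/
theorem IsDistanceHereditary.adj_lower (hG : IsDistanceHereditary G) {r x y z : V} {k : ℕ}
    (hx : AtLevel G r x (k + 1)) (hy : AtLevel G r y (k + 1)) (hz : AtLevel G r z k)
    (h : G.Adj x y ∨ ∃ v, AtLevel G r v (k + 2) ∧ G.Adj x v ∧ G.Adj y v) (hxz : G.Adj x z) :
    G.Adj y z := by
  have mem : ∀ {w j}, AtLevel G r w j → j ≠ k → w ∈ {w | AtLevel G r w k → w = z} :=
    fun hw hj hw' => absurd (hw.eq hw') hj
  refine hG.adj_of_reachable hy hz hxz rfl (mem hy (by omega)) (mem hx (by omega)) ?_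
  rcases h with h | ⟨v, hv, hxv, hyv⟩
  · exact reachable_induce_of_adj _ _ h.symm
  · exact (reachable_induce_of_adj _ (mem hv (by omega)) hyv).trans
      (reachable_induce_of_adj _ _ hxv.symm)

/-- `v` is a twin of `u`, or has no neighbour other than `u`. -/
def IsRemovable (G : SimpleGraph V) (u v : V) : Prop :=
  (∀ x, x ≠ u → x ≠ v → (G.Adj x u ↔ G.Adj x v)) ∨ ∀ x, x ≠ u → x ≠ v → ¬ G.Adj x v

/-- The vertices of the last level with the same lower neighbours as `p` form a cograph, having a
common neighbour, and a module, because adjacent vertices of a level agree on the level below. Twins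
in a module are twins in `G`. -/
theorem IsDistanceHereditary.exists_isRemovable_of_lastLevel [Fintype V]
    (hG : IsDistanceHereditary G) {r : V} {m : ℕ} (hmax : ∀ x k, AtLevel G r x k → k ≤ m + 1)
    {p q : V} (hpq : p ≠ q) (hp : AtLevel G r p (m + 1)) (hq : AtLevel G r q (m + 1))
    (h : ∀ z, AtLevel G r z m → (G.Adj p z ↔ G.Adj q z)) : ∃ u v, u ≠ v ∧ IsRemovable G u v := by
  classical
  let C : Finset V := Finset.univ.filter fun x =>
    AtLevel G r x (m + 1) ∧ ∀ z, AtLevel G r z m → (G.Adj p z ↔ G.Adj x z)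
  have hC : ∀ x, x ∈ C ↔ AtLevel G r x (m + 1) ∧
      ∀ z, AtLevel G r z m → (G.Adj p z ↔ G.Adj x z) := by simp [C]
  obtain ⟨t, hpt, ht⟩ := hp.exists_lower
  have hcog : IsCographOn G C :=
    hG.isCographOn (t := t) fun x hx => ((((hC x).1 hx).2 t ht).1 hpt).symm
  obtain ⟨u, hu, v, hv, huv, htw⟩ := hcog.exists_twins (Finset.one_lt_card.2
    ⟨p, (hC p).2 ⟨hp, fun _ _ => Iff.rfl⟩, q, (hC q).2 ⟨hq, h⟩, hpq⟩)
  have key : ∀ x ∉ C, ∀ u ∈ C, ∀ v ∈ C, G.Adj x u → G.Adj x v := by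
    intro x hx u hu v hv hxu
    rw [hC] at hu hv
    obtain ⟨j, hj, _, hj2⟩ := hu.1.exists_of_adj hxu.symm
    have := hmax x j hj
    obtain rfl | rfl : j = m ∨ j = m + 1 := by omega
    · exact ((hv.2 x hj).1 ((hu.2 x hj).2 hxu.symm)).symm
    · refine absurd ((hC x).2 ⟨hj, fun z hz => (hu.2 z hz).trans ⟨?_, ?_⟩⟩) hx
      · exact hG.adj_lower hu.1 hj hz (Or.inl hxu.symm)
      · exact hG.adj_lower hj hu.1 hz (Or.inl hxu)
  refine ⟨u, v, huv, Or.inl fun x hxu hxv => ?_⟩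
  by_cases hx : x ∈ C
  · exact htw x hx hxu hxv
  · exact ⟨key x hx u hu v hv, key x hx v hv u hu⟩

/-- This makes the neighbourhood of `v` a module. If `x` saw `a` but not `b`, then either
`adj_lower` gives a contradiction at once, or a path from `x` to `v` through `t` and `b` contains no
common neighbour of its ends, although `a` is one. -/
theorem IsDistanceHereditary.adj_of_minimal [Fintype V] [DecidableRel G.Adj]
    (hG : IsDistanceHereditary G) {r : V}
    {m : ℕ} (hmax : ∀ x k, AtLevel G r x k → k ≤ m + 2)
    (hind : ∀ x y, AtLevel G r x (m + 2) → AtLevel G r y (m + 2) → ¬ G.Adj x y)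
    {v : V} (hv : AtLevel G r v (m + 2))
    (hmin : ∀ x, AtLevel G r x (m + 2) → (G.neighborFinset v).card ≤ (G.neighborFinset x).card)
    {a b x : V} (ha : G.Adj v a) (hb : G.Adj v b) (hx : ¬ G.Adj v x) (hxa : G.Adj x a) :
    G.Adj x b := by
  have hlev : ∀ x y, AtLevel G r x (m + 2) → G.Adj x y → AtLevel G r y (m + 1) := by
    intro x y hx hxy
    obtain ⟨j, hj, _, hj2⟩ := hx.exists_of_adj hxy
    have := hmax _ _ hj
    obtain rfl | rfl : j = m + 1 ∨ j = m + 2 := by omega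
    · exact hj
    · exact absurd hxy (hind x y hx hj)
  have hla := hlev v a hv ha
  have hlb := hlev v b hv hb
  obtain ⟨t, hat, ht⟩ := hla.exists_lower
  have hbt : G.Adj b t := hG.adj_lower hla hlb ht (Or.inr ⟨v, hv, ha.symm, hb.symm⟩) hat
  have htv : ¬ G.Adj t v := fun h => by have := ht.eq (hlev v t hv h.symm); omega
  by_contra hxb
  have hxv : x ≠ v := fun h => hxb (h ▸ hb)
  obtain ⟨j, hj, hj1, hj2⟩ := hla.exists_of_adj hxa.symm
  obtain rfl | rfl | rfl : j = m ∨ j = m + 1 ∨ j = m + 2 := by omega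
  · exact hxb (hG.adj_lower hla hlb hj (Or.inr ⟨v, hv, ha.symm, hb.symm⟩) hxa.symm).symm
  · have hxt : G.Adj x t := hG.adj_lower hla hj ht (Or.inl hxa.symm) hat
    let U : Set V := {x, t, b, v}
    have mx : x ∈ U := by simp [U]
    have mt : t ∈ U := by simp [U]
    have mb : b ∈ U := by simp [U]
    have mv : v ∈ U := by simp [U]
    obtain ⟨s, hs, hs1, hs2⟩ := hG.exists_common_nbr (u := ⟨x, mx⟩) (v := ⟨v, mv⟩)
      ((reachable_induce_of_adj mx mt hxt).trans ((reachable_induce_of_adj mt mb hbt.symm).trans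
        (reachable_induce_of_adj mb mv hb.symm))) (by simpa using hxv) (fun h => hx h.symm)
      hxa ha.symm
    rcases hs with rfl | rfl | rfl | rfl
    · exact G.loopless.irrefl _ hs1
    · exact htv hs2
    · exact hxb hs1
    · exact G.loopless.irrefl _ hs2
  -- As `b` is a neighbour of `v` but not of `x`, minimality of the degree of `v` forces a neighbour
  -- of `x` that `v` misses.
  · obtain ⟨c, hcx, hcv⟩ : ∃ c ∈ G.neighborFinset x, c ∉ G.neighborFinset v := by
      by_contra! hsub
      have := Finset.eq_of_subset_of_card_le (fun c hc => hsub c hc) (hmin x hj)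
      have hbv : b ∈ G.neighborFinset v := by simpa using hb
      rw [← this] at hbv
      exact hxb (by simpa using hbv)
    rw [mem_neighborFinset] at hcx hcv
    have hct : G.Adj c t := hG.adj_lower hla (hlev x c hj hcx) ht
      (Or.inr ⟨x, hj, hxa.symm, hcx.symm⟩) hat
    let U : Set V := {x, c, t, b, v}
    have mx : x ∈ U := by simp [U]
    have mc : c ∈ U := by simp [U]
    have mt : t ∈ U := by simp [U]
    have mb : b ∈ U := by simp [U]
    have mv : v ∈ U := by simp [U]
    obtain ⟨s, hs, hs1, hs2⟩ := hG.exists_common_nbr (u := ⟨x, mx⟩) (v := ⟨v, mv⟩)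
      ((reachable_induce_of_adj mx mc hcx).trans ((reachable_induce_of_adj mc mt hct).trans
        ((reachable_induce_of_adj mt mb hbt.symm).trans
        (reachable_induce_of_adj mb mv hb.symm)))) (by simpa using hxv) (fun h => hx h.symm)
      hxa ha.symm
    rcases hs with rfl | rfl | rfl | rfl | rfl
    · exact G.loopless.irrefl _ hs1
    · exact hcv hs2.symm
    · exact htv hs2
    · exact hxb hs1
    · exact G.loopless.irrefl _ hs2

/-- A distance-hereditary graph with at least two vertices has twins, a pendant vertex or an
isolated vertex. -/
theorem IsDistanceHereditary.exists_isRemovable [Fintype V] [Nontrivial V]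
    (hG : IsDistanceHereditary G) : ∃ u v, u ≠ v ∧ IsRemovable G u v := by
  classical
  by_cases hedge : ∃ r s, G.Adj r s
  swap
  · push Not at hedge
    obtain ⟨u, v, huv⟩ := exists_pair_ne V
    exact ⟨u, v, huv, Or.inr fun x _ _ => hedge x v⟩
  obtain ⟨r, s, hrs⟩ := hedge
  have hs : AtLevel G r s 1 := ⟨hrs.symm.reachable, dist_eq_one_iff_adj.2 hrs.symm⟩
  obtain ⟨w, hw, hwmax⟩ := Finset.exists_max_image (Finset.univ.filter fun x => G.Reachable x r)
    (fun x => G.dist x r) ⟨s, by simpa using hs.1⟩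
  have hw1 : 1 ≤ G.dist w r := hs.2 ▸ hwmax s (by simpa using hs.1)
  obtain ⟨m, hm⟩ : ∃ m, G.dist w r = m + 1 := ⟨G.dist w r - 1, by omega⟩
  have hw : AtLevel G r w (m + 1) := ⟨(Finset.mem_filter.1 hw).2, hm⟩
  have hmax : ∀ x k, AtLevel G r x k → k ≤ m + 1 := fun x k hx => by
    rw [← hx.2, ← hm]; exact hwmax x (Finset.mem_filter.2 ⟨Finset.mem_univ _, hx.1⟩)
  -- If no two vertices of the last level agree on the level below, the last level is independent,
  -- since adjacent ones would agree.
  by_cases hA : ∃ p q, p ≠ q ∧ AtLevel G r p (m + 1) ∧ AtLevel G r q (m + 1) ∧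
      ∀ z, AtLevel G r z m → (G.Adj p z ↔ G.Adj q z)
  · obtain ⟨p, q, hpq, hp, hq, h⟩ := hA
    exact hG.exists_isRemovable_of_lastLevel hmax hpq hp hq h
  have hind : ∀ x y, AtLevel G r x (m + 1) → AtLevel G r y (m + 1) → ¬ G.Adj x y :=
    fun x y hx hy hxy => hA ⟨x, y, hxy.ne, hx, hy, fun z hz =>
      ⟨hG.adj_lower hx hy hz (Or.inl hxy), hG.adj_lower hy hx hz (Or.inl hxy.symm)⟩⟩
  obtain ⟨v, hv, hmin⟩ := Finset.exists_min_image
    (Finset.univ.filter fun x => AtLevel G r x (m + 1)) (fun x => (G.neighborFinset x).card)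
    ⟨w, by simpa using hw⟩
  replace hv : AtLevel G r v (m + 1) := by simpa using hv
  replace hmin : ∀ x, AtLevel G r x (m + 1) →
      (G.neighborFinset v).card ≤ (G.neighborFinset x).card := fun x hx =>
    hmin x (by simpa using hx)
  obtain ⟨t, hvt, ht⟩ := hv.exists_lower
  by_cases hpend : ∀ x, G.Adj v x → x = t
  · exact ⟨t, v, hvt.ne', Or.inr fun x hxt _ h => hxt (hpend x h.symm)⟩
  push Not at hpend
  obtain ⟨t', hvt', htt'⟩ := hpend
  have hlow : ∀ x, G.Adj v x → AtLevel G r x m := by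
    intro x hvx
    obtain ⟨j, hj, _, hj2⟩ := hv.exists_of_adj hvx
    have := hmax _ _ hj
    obtain rfl | rfl : j = m ∨ j = m + 1 := by omega
    · exact hj
    · exact absurd hvx (hind v x hv hj)
  cases m with
  -- Level `0` is `r` alone, too small for two neighbours of `v`.
  | zero => exact absurd ((hlow t' hvt').eq_root.trans ht.eq_root.symm) htt'
  | succ m =>
    obtain ⟨t0, htt0, ht0⟩ := ht.exists_lower
    have hcog : IsCographOn G (G.neighborFinset v) := hG.isCographOn (t := t0) fun x hx => by
      rw [mem_neighborFinset] at hx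
      exact (hG.adj_lower ht (hlow x hx) ht0 (Or.inr ⟨v, hv, hvt.symm, hx.symm⟩) htt0).symm
    -- The neighbours of `v` share the neighbour `t0`, so they form a cograph; by minimality of `v`
    -- they also form a module.
    obtain ⟨a, ha, b, hb, hab, htw⟩ := hcog.exists_twins (Finset.one_lt_card.2
      ⟨t, by simpa using hvt, t', by simpa using hvt', htt'.symm⟩)
    refine ⟨a, b, hab, Or.inl fun x hxa hxb => ?_⟩
    by_cases hx : x ∈ G.neighborFinset v
    · exact htw x hx hxa hxb
    · rw [mem_neighborFinset] at ha hb hx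
      exact ⟨hG.adj_of_minimal hmax hind hv hmin ha hb hx,
        hG.adj_of_minimal hmax hind hv hmin hb ha hx⟩

theorem IsDistanceHereditary.exists_isRemovable_induce (hG : IsDistanceHereditary G)
    (S : Finset V) (hS : 2 ≤ S.card) :
    ∃ u ∈ S, ∃ v ∈ S, u ≠ v ∧ ((∀ x ∈ S, x ≠ u → x ≠ v → (G.Adj x u ↔ G.Adj x v)) ∨
      ∀ x ∈ S, x ≠ u → x ≠ v → ¬ G.Adj x v) := by
  have : Nontrivial (S : Set V) :=
    Set.nontrivial_coe_sort.2 (Finset.one_lt_card_iff_nontrivial.1 hS)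
  obtain ⟨u, v, huv, h⟩ := (hG.induce (S : Set V)).exists_isRemovable
  refine ⟨u, u.2, v, v.2, fun e => huv (Subtype.ext e), h.imp (fun h x hx hxu hxv => ?_)
    fun h x hx hxu hxv => ?_⟩
  · exact h ⟨x, hx⟩ (fun e => hxu (congrArg Subtype.val e)) (fun e => hxv (congrArg Subtype.val e))
  · exact h ⟨x, hx⟩ (fun e => hxu (congrArg Subtype.val e)) (fun e => hxv (congrArg Subtype.val e))

end Structure

/-! ### Merging vertices without changing the attainable weights -/

section DynamicProgramming

variable {V : Type*} (G : SimpleGraph V)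

open Classical in
/-- The entries of the adjacency matrix. -/
noncomputable def adjEntry (x y : V) : ℤ := if G.Adj x y then 1 else 0

theorem adjEntry_comm (x y : V) : adjEntry G x y = adjEntry G y x := by
  classical exact if_congr (G.adj_comm x y) rfl rfl

@[simp] theorem adjEntry_self (x : V) : adjEntry G x x = 0 := by simp [adjEntry]

theorem abs_adjEntry_mul_le (x y : V) (s : ℤ) : |adjEntry G x y * s| ≤ |s| := by
  unfold adjEntry; split_ifs <;> simp

/-- The total weights of assignments of sums `s v` and weights `w v` to the vertices in `S`, subject
to the constraint `R v` on `s v`, the sum of `s` over the neighbours of `v` in `S`, and `w v`. -/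
def constrainedWeights (S : Finset V) (R : V → ℤ → ℤ → ℤ → Prop) : Set ℤ :=
  {W | ∃ s w : V → ℤ, (∀ v ∈ S, R v (s v) (∑ y ∈ S, adjEntry G v y * s y) (w v)) ∧
    W = ∑ v ∈ S, w v}

/-- The constraint `R` on the vertices in `S` represents minus domination in `G`. -/
def Represents [Fintype V] (S : Finset V) (R : V → ℤ → ℤ → ℤ → Prop) : Prop :=
  (Nonempty V → S.Nonempty) ∧
  (∃ size : V → ℤ, (∀ v ∈ S, 0 ≤ size v) ∧ ∑ v ∈ S, size v ≤ Fintype.card V ∧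
    ∀ v ∈ S, ∀ s d w, R v s d w → |s| ≤ size v ∧ |w| ≤ size v) ∧
  constrainedWeights G S R = minusDominationWeights G

/-- The constraint obtained by merging two vertices. -/
def mergedConstraint (n a b : ℤ) (Ru Rv : ℤ → ℤ → ℤ → Prop) (s d w : ℤ) : Prop :=
  ∃ s₁ s₂ w₁ w₂, |s₁| ≤ n ∧ |s₂| ≤ n ∧ |d| ≤ n ∧ |w₁| ≤ n ∧ |w₂| ≤ n ∧
    s = s₁ + b * s₂ ∧ w = w₁ + w₂ ∧ Ru s₁ (d + a * s₂) w₁ ∧ Rv s₂ (b * d + a * s₁) w₂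

/-- The constraint of a single vertex. -/
def vertexConstraint (n s d w : ℤ) : Prop :=
  |s| ≤ 1 ∧ 1 ≤ s + d ∧ w = s ∧ |d| ≤ n

theorem closedNbhdSum_eq [Fintype V] (f : V → ℤ) (x : V) :
    closedNbhdSum G f x = f x + ∑ y, adjEntry G x y * f y := by
  classical
  rw [closedNbhdSum, Finset.filter_or, Finset.sum_union, Finset.filter_eq' Finset.univ x]
  · simp [adjEntry, Finset.sum_filter]
  · rw [Finset.disjoint_filter]
    rintro y _ rfl
    exact G.loopless.irrefl y

/-- The starting point: each cluster is one vertex, of size `1`. The bound on `d` excludes nothing,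
since `|f| ≤ 1`. -/
theorem represents_univ [Fintype V] :
    Represents G Finset.univ fun _ => vertexConstraint (Fintype.card V) := by
  refine ⟨fun _ => Finset.univ_nonempty, ⟨fun _ => 1, by simp, by simp,
    fun v _ s d w h => ⟨h.1, h.2.2.1 ▸ h.1⟩⟩, ?_⟩
  ext W
  constructor
  · rintro ⟨s, w, h, rfl⟩
    refine ⟨s, ⟨fun x => ?_, fun x => ?_⟩,
      Finset.sum_congr rfl fun x hx => (h x hx).2.2.1⟩
    · have := (h x (Finset.mem_univ x)).1
      rw [abs_le] at this; omega
    · have := (h x (Finset.mem_univ x)).2.1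
      rw [closedNbhdSum_eq]; omega
  · rintro ⟨f, ⟨h1, h2⟩, rfl⟩
    have h1' : ∀ x, |f x| ≤ 1 := fun x => by
      rcases h1 x with h | h | h <;> simp [h]
    refine ⟨f, f, fun x _ => ⟨h1' x, ?_, rfl, ?_⟩, rfl⟩
    · have := h2 x
      rw [closedNbhdSum_eq] at this; omega
    · calc |∑ y, adjEntry G x y * f y| ≤ ∑ y, |adjEntry G x y * f y| :=
            Finset.abs_sum_le_sum_abs _ _
        _ ≤ ∑ y : V, 1 := Finset.sum_le_sum fun y _ => (abs_adjEntry_mul_le G x y _).trans (h1' y)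
        _ = Fintype.card V := by simp

variable {G}

/-- An assignment after the merge is one before it with the values at `u` and `v` combined. Sizes
add up and never exceed the number of vertices in total, so the bounds in `mergedConstraint` lose no
assignment. `R'` is given by equivalences because it will be read off the memory. -/
theorem Represents.merge [Fintype V] [DecidableEq V] {S : Finset V} {R R' : V → ℤ → ℤ → ℤ → Prop}
    (h : Represents G S R) {u v : V} (hu : u ∈ S) (hv : v ∈ S) (huv : u ≠ v) {b : ℤ} (hb : |b| ≤ 1)
    (hN : ∀ x ∈ S, x ≠ u → x ≠ v → adjEntry G x v = b * adjEntry G x u)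
    (hR : ∀ x ∈ S, x ≠ u → x ≠ v → ∀ s d w, R' x s d w ↔ R x s d w)
    (hRu : ∀ s d w, R' u s d w ↔
      mergedConstraint (Fintype.card V) (adjEntry G u v) b (R u) (R v) s d w) :
    Represents G (S.erase v) R' := by
  obtain ⟨-, ⟨size, hpos, hsum, hsize⟩, hw⟩ := h
  obtain ⟨S₀, hu₀, hv₀, rfl⟩ : ∃ S₀ : Finset V, u ∉ S₀ ∧ v ∉ insert u S₀ ∧
      S = insert v (insert u S₀) :=
    ⟨(S.erase v).erase u, by simp, by simp [huv.symm], by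
      rw [Finset.insert_erase (by simp [hu, huv]), Finset.insert_erase hv]⟩
  have hvS : v ∉ S₀ := fun h => hv₀ (Finset.mem_insert_of_mem h)
  rw [Finset.erase_insert hv₀]
  rw [Finset.sum_insert hv₀, Finset.sum_insert hu₀] at hsum
  have hne : ∀ x ∈ S₀, x ≠ u ∧ x ≠ v := fun x hx =>
    ⟨fun h => hu₀ (h ▸ hx), fun h => hvS (h ▸ hx)⟩
  have hmem : ∀ x ∈ S₀, x ∈ insert v (insert u S₀) := fun x hx => by simp [hx]
  have hN' : ∀ x ∈ S₀, adjEntry G x v = b * adjEntry G x u := fun x hx =>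
    hN x (hmem x hx) (hne x hx).1 (hne x hx).2
  have hsize₀ : 0 ≤ ∑ x ∈ S₀, size x := Finset.sum_nonneg fun x hx => hpos x (hmem x hx)
  have hpu := hpos u hu
  have hpv := hpos v hv
  -- What `v` receives from the other clusters is `b` times what `u` receives.
  have hsum_v : ∀ s : V → ℤ, ∑ y ∈ S₀, adjEntry G v y * s y =
      b * ∑ y ∈ S₀, adjEntry G u y * s y := fun s => by
    rw [Finset.mul_sum]
    refine Finset.sum_congr rfl fun y hy => ?_
    rw [adjEntry_comm G v y, hN' y hy, adjEntry_comm G u y, mul_assoc]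
  refine ⟨fun _ => ⟨u, Finset.mem_insert_self _ _⟩,
    ⟨Function.update size u (size u + size v), fun x hx => ?_, ?_, fun x hx s d w h => ?_⟩, ?_⟩
  · rcases Finset.mem_insert.1 hx with rfl | hx
    · simp; omega
    · rw [Function.update_of_ne (hne x hx).1]; exact hpos x (hmem x hx)
  · rw [Finset.sum_insert hu₀, Function.update_self, Finset.sum_update_of_notMem hu₀]; omega
  · rcases Finset.mem_insert.1 hx with rfl | hx
    · obtain ⟨s₁, s₂, w₁, w₂, -, -, -, -, -, rfl, rfl, h1, h2⟩ := (hRu s d w).1 h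
      have h1 := hsize _ hu _ _ _ h1
      have h2 := hsize _ hv _ _ _ h2
      have h3 : |b * s₂| ≤ |s₂| := by
        rw [abs_mul]; exact mul_le_of_le_one_left (abs_nonneg _) hb
      have h4 := abs_add_le s₁ (b * s₂)
      have h5 := abs_add_le w₁ w₂
      rw [Function.update_self]
      constructor <;> linarith [h1.1, h1.2, h2.1, h2.2]
    · rw [Function.update_of_ne (hne x hx).1]
      exact hsize x (hmem x hx) s d w ((hR x (hmem x hx) (hne x hx).1 (hne x hx).2 s d w).1 h)
  rw [← hw]
  ext W
  constructor
  · rintro ⟨s, w, hsw, rfl⟩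
    have h := (hRu _ _ _).1 (hsw u (by simp))
    obtain ⟨s₁, s₂, w₁, w₂, -, -, -, -, -, hs, hw, h1, h2⟩ := h
    rw [Finset.sum_insert hu₀, adjEntry_self, zero_mul, zero_add] at h1 h2
    have hs0 : ∀ (c : ℤ) x, x ∈ S₀ → Function.update (Function.update s u s₁) v c x = s x :=
      fun c x hx => by rw [Function.update_of_ne (hne x hx).2, Function.update_of_ne (hne x hx).1]
    have hS0 : ∀ x, ∑ y ∈ S₀, adjEntry G x y * Function.update (Function.update s u s₁) v s₂ y =
        ∑ y ∈ S₀, adjEntry G x y * s y := fun x =>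
      Finset.sum_congr rfl fun y hy => by rw [hs0 _ y hy]
    refine ⟨Function.update (Function.update s u s₁) v s₂,
      Function.update (Function.update w u w₁) v w₂, fun x hx => ?_, ?_⟩
    · rw [Finset.sum_insert hv₀, Finset.sum_insert hu₀, hS0, Function.update_self,
        Function.update_of_ne huv, Function.update_self]
      rcases Finset.mem_insert.1 hx with rfl | hx
      · rw [Function.update_self, Function.update_self, hsum_v, adjEntry_self, adjEntry_comm G x u]
        convert h2 using 1; ring
      · rcases Finset.mem_insert.1 hx with rfl | hx
        · rw [Function.update_of_ne huv, Function.update_self, Function.update_of_ne huv,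
            Function.update_self, adjEntry_self]
          convert h1 using 1; ring
        · rw [hs0 _ x hx, Function.update_of_ne (hne x hx).2, Function.update_of_ne (hne x hx).1,
            hN' x hx, ← hR x (hmem x hx) (hne x hx).1 (hne x hx).2]
          have := hsw x (by simp [hx])
          rw [Finset.sum_insert hu₀, hs] at this
          convert this using 1; ring
    · rw [Finset.sum_insert hv₀, Finset.sum_insert hu₀, Finset.sum_insert hu₀, Function.update_self,
        Function.update_of_ne huv, Function.update_self, hw,
        Finset.sum_congr (f := Function.update (Function.update w u w₁) v w₂) (g := w) rfl
          fun x hx => by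
          rw [Function.update_of_ne (hne x hx).2, Function.update_of_ne (hne x hx).1]]
      ring
  · rintro ⟨s, w, hsw, rfl⟩
    have hsz : ∀ x ∈ insert v (insert u S₀), |s x| ≤ size x ∧ |w x| ≤ size x := fun x hx =>
      hsize x hx _ _ _ (hsw x hx)
    have hS0 : ∀ x c, ∑ y ∈ S₀, adjEntry G x y * Function.update s u c y =
        ∑ y ∈ S₀, adjEntry G x y * s y := fun x c =>
      Finset.sum_congr rfl fun y hy => by rw [Function.update_of_ne (hne y hy).1]
    refine ⟨Function.update s u (s u + b * s v), Function.update w u (w u + w v),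
      fun x hx => ?_, ?_⟩
    · rw [Finset.sum_insert hu₀, hS0, Function.update_self]
      rcases Finset.mem_insert.1 hx with rfl | hx
      · rw [Function.update_self, Function.update_self, hRu, adjEntry_self, zero_mul, zero_add]
        have h1 := hsw x hu
        have h2 := hsw v hv
        rw [Finset.sum_insert hv₀, Finset.sum_insert hu₀] at h1 h2
        rw [hsum_v, adjEntry_self, adjEntry_comm G v x] at h2
        rw [adjEntry_self] at h1
        have hu' := hsz x hu
        have hv' := hsz v hv
        -- The sum received from outside is bounded by the sizes of the other clusters.
        have hd : |∑ y ∈ S₀, adjEntry G x y * s y| ≤ ∑ y ∈ S₀, size y :=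
          (Finset.abs_sum_le_sum_abs _ _).trans (Finset.sum_le_sum fun y hy =>
            (abs_adjEntry_mul_le G x y _).trans (hsz y (hmem y hy)).1)
        refine ⟨s x, s v, w x, w v, ?_, ?_, ?_, ?_, ?_, rfl, rfl, ?_, ?_⟩
        · linarith [hu'.1]
        · linarith [hv'.1]
        · linarith
        · linarith [hu'.2]
        · linarith [hv'.2]
        · convert h1 using 1; ring
        · convert h2 using 1; ring
      · rw [Function.update_of_ne (hne x hx).1, Function.update_of_ne (hne x hx).1,
          hR x (hmem x hx) (hne x hx).1 (hne x hx).2]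
        have := hsw x (hmem x hx)
        rw [Finset.sum_insert hv₀, Finset.sum_insert hu₀, hN' x hx] at this
        convert this using 1; ring
    · rw [Finset.sum_insert hv₀, Finset.sum_insert hu₀, Finset.sum_insert hu₀, Function.update_self,
        Finset.sum_congr (f := Function.update w u _) (g := w) rfl fun x hx => by
          rw [Function.update_of_ne (hne x hx).1]]
      ring

end DynamicProgramming

/-! ### A language of bounded loops with time bounds and proof rules -/

section Commands

/-- Programs whose only loops are bounded: `range x c` runs `c` for `x = -n, …, n`, where `n` is the
value of the scalar variable `0`. -/
inductive Cmd : Type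
  | skip : Cmd
  | assign (x : ℕ) (idx : List ℕ) (e : Expr) : Cmd
  | seq (c d : Cmd) : Cmd
  | ite (b : Test) (c d : Cmd) : Cmd
  | range (x : ℕ) (c : Cmd) : Cmd

namespace Cmd

/-- Whether the array `y` may be written to. -/
def writes (y : ℕ) : Cmd → Bool
  | skip => false
  | assign x _ _ => y == x
  | seq c d => c.writes y || d.writes y
  | ite _ c d => c.writes y || d.writes y
  | range x c => y == x || c.writes y

/-- The loop variables are not written to in the loop, and the variable `0` is not written to. -/
def wellFormed : Cmd → Bool
  | skip => true
  | assign x _ _ => x != 0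
  | seq c d => c.wellFormed && d.wellFormed
  | ite _ c d => c.wellFormed && d.wellFormed
  | range x c => x != 0 && (!c.writes x && c.wellFormed)

/-- The translation into a program. -/
def compile : Cmd → Program
  | skip => .skip
  | assign x idx e => .assign x idx e
  | seq c d => .seq c.compile d.compile
  | ite b c d => .branch b c.compile d.compile
  | range x c => .seq (.assign x [] (.sub (.const 0) (.cell 0 [])))
      (.loop (.le (.cell x []) (.cell 0 []))
        (.seq c.compile (.assign x [] (.add (.cell x []) (.const 1)))))

/-- One iteration of a loop. -/
def iteration (x : ℕ) (F : Memory → Memory) (m : Memory) : Memory :=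
  (F m).write x [] (F m x [] + 1)

open Classical in
/-- The memory after the execution, if the variable `0` has the value `n`. -/
noncomputable def denote (n : ℕ) : Cmd → Memory → Memory
  | skip, m => m
  | assign x idx e, m => m.write x (m.address idx) (e.eval m)
  | seq c d, m => d.denote n (c.denote n m)
  | ite b c d, m => if b.Holds m then c.denote n m else d.denote n m
  | range x c, m => (iteration x (c.denote n))^[2 * n + 1] (m.write x [] (-n))

open Polynomial in
/-- A bound on the running time. -/
noncomputable def cost : Cmd → ℕ[X]
  | skip => 1
  | assign _ idx e => C (1 + idx.length + e.cost)
  | seq c d => c.cost + d.cost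
  | ite b c d => C (1 + b.cost) + c.cost + d.cost
  | range _ c => 8 + (2 * X + 1) * (8 + c.cost)

end Cmd

theorem Memory.write_of_ne {m : Memory} {x y : ℕ} (h : y ≠ x) (a b : List ℤ) (z : ℤ) :
    m.write x a z y b = m y b := by simp [Memory.write, h]

@[simp] theorem Memory.write_self (m : Memory) (x : ℕ) (a : List ℤ) (z : ℤ) :
    m.write x a z x a = z := by simp [Memory.write]

namespace Cmd

/-- The frame rule: it reduces the preservation of arrays to a syntactic check, usually settled by
`decide`. -/
theorem denote_of_not_writes {n : ℕ} {c : Cmd} {y : ℕ} (h : c.writes y = false) (m : Memory) :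
    c.denote n m y = m y := by
  funext a
  induction c generalizing m a with
  | skip => rfl
  | assign x idx e =>
    simp only [writes, beq_eq_false_iff_ne] at h
    exact Memory.write_of_ne h _ _ _
  | seq c d ihc ihd =>
    simp only [writes, Bool.or_eq_false_iff] at h
    exact (ihd h.2 _ _).trans (ihc h.1 _ _)
  | ite b c d ihc ihd =>
    simp only [writes, Bool.or_eq_false_iff] at h
    rw [denote]
    split_ifs
    exacts [ihc h.1 _ _, ihd h.2 _ _]
  | range x c ih =>
    simp only [writes, Bool.or_eq_false_iff, beq_eq_false_iff_ne] at h
    have : ∀ k m, (iteration x (c.denote n))^[k] m y a = m y a := by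
      intro k
      induction k with
      | zero => exact fun _ => rfl
      | succ k ihk =>
        intro m
        rw [Function.iterate_succ_apply, ihk, iteration, Memory.write_of_ne h.1, ih h.2]
    rw [denote, this, Memory.write_of_ne h.1]

theorem not_writes_zero {c : Cmd} (h : c.wellFormed = true) : c.writes 0 = false := by
  induction c with
  | skip => rfl
  | assign x idx e =>
    simp only [wellFormed, bne_iff_ne] at h
    simpa [writes] using h.symm
  | seq c d ihc ihd =>
    simp only [wellFormed, Bool.and_eq_true] at h
    simp [writes, ihc h.1, ihd h.2]
  | ite b c d ihc ihd =>
    simp only [wellFormed, Bool.and_eq_true] at h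
    simp [writes, ihc h.1, ihd h.2]
  | range x c ih =>
    simp only [wellFormed, Bool.and_eq_true, bne_iff_ne] at h
    simp [writes, ih h.2.2, h.1.symm]

/-- Every loop makes exactly `2 * n + 1` rounds, because well-formedness protects `n` and the loop
variable from the body. -/
theorem runs_compile {n : ℕ} {c : Cmd} (h : c.wellFormed = true) {m : Memory}
    (hm : m 0 [] = n) : ∃ t ≤ c.cost.eval n, Runs c.compile m (c.denote n m) t := by
  induction c generalizing m with
  | skip => exact ⟨1, by simp [cost], .skip m⟩
  | assign x idx e => exact ⟨_, by simp [cost], .assign x idx e m⟩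
  | seq c d ihc ihd =>
    simp only [wellFormed, Bool.and_eq_true] at h
    obtain ⟨t₁, h₁, r₁⟩ := ihc h.1 hm
    have hm' : c.denote n m 0 [] = n := by rw [denote_of_not_writes (not_writes_zero h.1), hm]
    obtain ⟨t₂, h₂, r₂⟩ := ihd h.2 hm'
    exact ⟨t₁ + t₂, by rw [cost, Polynomial.eval_add]; omega, .seq r₁ r₂⟩
  | ite b c d ihc ihd =>
    simp only [wellFormed, Bool.and_eq_true] at h
    obtain ⟨t₁, h₁, r₁⟩ := ihc h.1 hm
    obtain ⟨t₂, h₂, r₂⟩ := ihd h.2 hm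
    by_cases hb : b.Holds m
    · refine ⟨_, ?_, by rw [denote, if_pos hb]; exact .branch_pos hb r₁⟩
      rw [cost, Polynomial.eval_add, Polynomial.eval_add, Polynomial.eval_C]; omega
    · refine ⟨_, ?_, by rw [denote, if_neg hb]; exact .branch_neg hb r₂⟩
      rw [cost, Polynomial.eval_add, Polynomial.eval_add, Polynomial.eval_C]; omega
  | range x c ih =>
    simp only [wellFormed, Bool.and_eq_true, bne_iff_ne, Bool.not_eq_true'] at h
    obtain ⟨hx, hcx, hc⟩ := h
    -- Here `k` counts the rounds still to come. The `4` pays for the final failing test, and the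
    -- `8` for test and increment in each round; the initial assignment costs another `4`.
    have loop : ∀ (k : ℕ) (m : Memory), m 0 [] = n → m x [] = n + 1 - k →
        ∃ t ≤ 4 + k * (8 + c.cost.eval n),
        Runs (.loop (.le (.cell x []) (.cell 0 []))
          (.seq c.compile (.assign x [] (.add (.cell x []) (.const 1))))) m
          ((iteration x (c.denote n))^[k] m) t := by
      intro k
      induction k with
      | zero =>
        intro m hm hmx
        refine ⟨_, ?_, .loop_done ?_⟩
        · simp [Test.cost, Expr.cost]
        · simp only [Test.Holds, Expr.eval, Memory.address, List.map_nil]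
          omega
      | succ k ihk =>
        intro m hm hmx
        obtain ⟨t₁, h₁, r₁⟩ := ih hc hm
        have e0 : c.denote n m 0 [] = n := by rw [denote_of_not_writes (not_writes_zero hc), hm]
        have ex : c.denote n m x [] = m x [] := by rw [denote_of_not_writes hcx]
        obtain ⟨t₂, h₂, r₂⟩ := ihk (iteration x (c.denote n) m)
          (by rw [iteration, Memory.write_of_ne hx.symm, e0])
          (by rw [iteration, Memory.write_self, ex, hmx]; push_cast; ring)
        refine ⟨_, ?_, .loop_step ?_ (.seq r₁ (.assign x [] _ _)) r₂⟩
        · simp only [Test.cost, Expr.cost, List.length_nil]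
          rw [add_mul]; omega
        · simp only [Test.Holds, Expr.eval, Memory.address, List.map_nil]
          push_cast at hmx; omega
    obtain ⟨t, ht, r⟩ := loop (2 * n + 1) (m.write x [] (-n))
      (by rw [Memory.write_of_ne hx.symm, hm]) (by rw [Memory.write_self]; push_cast; ring)
    have r0 := Runs.assign x [] (.sub (.const 0) (.cell 0 [])) m
    simp only [Expr.eval, Memory.address, List.map_nil, hm, zero_sub] at r0
    refine ⟨_, ?_, .seq r0 r⟩
    simp only [Expr.cost, List.length_nil, cost]
    simp only [Polynomial.eval_add, Polynomial.eval_mul, Polynomial.eval_X, Polynomial.eval_ofNat,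
      Polynomial.eval_one]
    omega

/-- Nested loops. -/
def ranges (xs : List ℕ) (c : Cmd) : Cmd := xs.foldr range c

/-- The induction rule for loops. -/
theorem denote_range_induction {n : ℕ} {x : ℕ} {c : Cmd} (hc : c.writes x = false)
    (I : ℤ → Memory → Prop) {m : Memory} (h₀ : I (-n) (m.write x [] (-n)))
    (h : ∀ (i : ℤ) (m : Memory), |i| ≤ n → m x [] = i → I i m →
      I (i + 1) ((c.denote n m).write x [] (i + 1))) :
    I (n + 1) ((range x c).denote n m) := by
  have : ∀ k : ℕ, k ≤ 2 * n + 1 →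
      ((iteration x (c.denote n))^[k] (m.write x [] (-n))) x [] = -n + k ∧
      I (-n + k) ((iteration x (c.denote n))^[k] (m.write x [] (-n))) := by
    intro k
    induction k with
    | zero => intro _; simpa using h₀
    | succ k ih =>
      intro hk
      obtain ⟨h1, h2⟩ := ih (by omega)
      rw [Function.iterate_succ_apply', iteration, denote_of_not_writes hc, h1, Memory.write_self]
      have := h _ _ (by rw [abs_le]; omega) h1 h2
      push_cast
      rw [← add_assoc]
      exact ⟨rfl, this⟩
  have := (this (2 * n + 1) le_rfl).2
  rwa [show -(n : ℤ) + (2 * n + 1 : ℕ) = n + 1 by push_cast; ring] at this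

/-- If the loop body keeps `J` and brings about `E i`, where `i` is the value of the loop variable,
then the loop brings about `E i` for all `i`. -/
theorem denote_range {n : ℕ} {x : ℕ} {c : Cmd} (hc : c.writes x = false)
    {J : Memory → Prop} {E : ℤ → Memory → Prop}
    (hJ : ∀ m z, J m → J (m.write x [] z)) (hE : ∀ i m z, E i m → E i (m.write x [] z))
    (h : ∀ m, J m → |m x []| ≤ n → J (c.denote n m) ∧ E (m x []) (c.denote n m))
    (hmono : ∀ (i : ℤ) (m : Memory), |i| ≤ n → J m → |m x []| ≤ n → E i m → E i (c.denote n m))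
    {m : Memory} (hm : J m) :
    J ((range x c).denote n m) ∧ ∀ i : ℤ, |i| ≤ n → E i ((range x c).denote n m) := by
  have := denote_range_induction (n := n) hc (fun i m => J m ∧ ∀ j : ℤ, -n ≤ j → j < i → E j m)
    (m := m)
    ⟨hJ _ _ hm, fun j _ _ => by omega⟩ (by
      rintro i m hi hmi ⟨h1, h2⟩
      have hi' := abs_le.1 hi
      rw [← hmi] at hi
      refine ⟨hJ _ _ (h m h1 hi).1, fun j hj hj' => hE _ _ _ ?_⟩
      rcases (Int.lt_add_one_iff.1 hj').eq_or_lt with rfl | hlt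
      · exact hmi ▸ (h m h1 hi).2
      · exact hmono j m (abs_le.2 ⟨hj, by omega⟩) h1 hi (h2 j hj hlt))
  refine ⟨this.1, fun i hi => ?_⟩
  have hi := abs_le.1 hi
  exact this.2 i hi.1 (by omega)

theorem writes_ranges {xs : List ℕ} {c : Cmd} {y : ℕ} (hy : y ∉ xs) (h : c.writes y = false) :
    (ranges xs c).writes y = false := by
  induction xs with
  | nil => exact h
  | cons x xs ih =>
    rw [List.mem_cons, not_or] at hy
    have := ih hy.2
    simp only [ranges] at this
    simp [ranges, writes, this, hy.1]

/-- `J` is the invariant, and `E l` is the effect of the round in which the loop variables have the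
values `l`. Effects need to be stable, since later rounds must not undo them. -/
theorem denote_ranges {n : ℕ} {xs : List ℕ} {c : Cmd} (hnd : xs.Nodup)
    (hc : ∀ x ∈ xs, c.writes x = false) {J : Memory → Prop} {E : List ℤ → Memory → Prop}
    (hJ : ∀ x ∈ xs, ∀ m z, J m → J (m.write x [] z))
    (hE : ∀ x ∈ xs, ∀ l m z, E l m → E l (m.write x [] z))
    (h : ∀ m, J m → (∀ x ∈ xs, |m x []| ≤ n) →
      J (c.denote n m) ∧ E (xs.map fun x => m x []) (c.denote n m))
    (hmono : ∀ l m, J m → (∀ x ∈ xs, |m x []| ≤ n) → E l m → E l (c.denote n m))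
    {m : Memory} (hm : J m) :
    J ((ranges xs c).denote n m) ∧ ∀ l : List ℤ, l.length = xs.length → (∀ z ∈ l, |z| ≤ n) →
      E l ((ranges xs c).denote n m) := by
  induction xs generalizing J E m with
  | nil =>
    obtain ⟨h1, h2⟩ := h m hm (by simp)
    exact ⟨h1, fun l hl _ => by rw [List.eq_nil_of_length_eq_zero hl]; exact h2⟩
  | cons x xs ih =>
    rw [List.nodup_cons] at hnd
    have hne : ∀ y ∈ xs, x ≠ y := fun y hy h => hnd.1 (h ▸ hy)
    simp only [List.forall_mem_cons] at hc hJ hE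
    -- `P` is an extra property to be carried through the inner loops: `True` when effects are
    -- established, and an earlier effect `E (i :: l)` when it is to be preserved.
    have inner : ∀ (i : ℤ) (P : Memory → Prop), |i| ≤ n →
        (∀ y ∈ xs, ∀ m z, P m → P (m.write y [] z)) →
        (∀ m, J m → m x [] = i → (∀ y ∈ xs, |m y []| ≤ n) → P m → P (c.denote n m)) → ∀ m, J m →
        m x [] = i → P m → (J ((ranges xs c).denote n m) ∧ P ((ranges xs c).denote n m)) ∧
        ∀ l : List ℤ, l.length = xs.length → (∀ z ∈ l, |z| ≤ n) →
          E (i :: l) ((ranges xs c).denote n m) := by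
      intro i P hi hP hP' m hm hmi hPm
      have := ih (J := fun m => J m ∧ m x [] = i ∧ P m) (E := fun l => E (i :: l)) hnd.2 hc.2
        (fun y hy m z hm => ⟨hJ.2 y hy m z hm.1, by
          rw [Memory.write_of_ne (hne y hy)]; exact hm.2.1, hP y hy m z hm.2.2⟩)
        (fun y hy l => hE.2 y hy _)
        (fun m hm hxs => by
          have := h m hm.1 (List.forall_mem_cons.2 ⟨hm.2.1 ▸ hi, hxs⟩)
          rw [List.map_cons, hm.2.1] at this
          refine ⟨⟨this.1, ?_, hP' m hm.1 hm.2.1 hxs hm.2.2⟩, this.2⟩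
          rw [denote_of_not_writes hc.1]; exact hm.2.1)
        (fun l m hm hxs => hmono _ m hm.1 (List.forall_mem_cons.2 ⟨hm.2.1 ▸ hi, hxs⟩))
        ⟨hm, hmi, hPm⟩
      exact ⟨⟨this.1.1, this.1.2.2⟩, this.2⟩
    have := denote_range (n := n) (c := ranges xs c) (x := x) (J := J)
      (E := fun i m => ∀ l : List ℤ, l.length = xs.length → (∀ z ∈ l, |z| ≤ n) → E (i :: l) m)
      (writes_ranges hnd.1 hc.1) hJ.1 (fun i m z h l hl hl' => hE.1 _ _ _ (h l hl hl'))
      (fun m hm hmx => by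
        have := inner _ (fun _ => True) hmx (fun _ _ _ _ h => h) (fun _ _ _ _ h => h) m hm rfl
          trivial
        exact ⟨this.1.1, this.2⟩)
      (fun i m hi hm hmx hEm l hl hl' =>
        (inner _ (E (i :: l)) hmx (fun y hy => hE.2 y hy _)
          (fun m hm hmi hxs => hmono _ m hm (List.forall_mem_cons.2 ⟨hmi ▸ hmx, hxs⟩))
          m hm rfl (hEm l hl hl')).1.2) hm
    refine ⟨this.1, fun l hl hl' => ?_⟩
    cases l with
    | nil => simp at hl
    | cons i l =>
      rw [List.forall_mem_cons] at hl'
      exact this.2 i hl'.1 l (by simpa using hl) hl'.2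

end Cmd

end Commands

/-! ### The algorithm -/

section Algorithm

namespace Cmd

theorem denote_skip (n : ℕ) (m : Memory) : skip.denote n m = m := rfl

theorem denote_seq (n : ℕ) (c d : Cmd) (m : Memory) :
    (seq c d).denote n m = d.denote n (c.denote n m) := rfl

theorem denote_assign_apply (n : ℕ) (x : ℕ) (idx : List ℕ) (e : Expr) (m : Memory) (y : ℕ)
    (a : List ℤ) : (assign x idx e).denote n m y a =
      if y = x ∧ a = idx.map (fun i => m i []) then e.eval m else m y a := rfl

open Classical in
theorem denote_ite_apply (n : ℕ) (b : Test) (c d : Cmd) (m : Memory) (y : ℕ) (a : List ℤ) :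
    (ite b c d).denote n m y a = if b.Holds m then c.denote n m y a else d.denote n m y a := by
  rw [denote]; split_ifs <;> rfl

end Cmd

/-- The scalar variable `x`. -/
abbrev Expr.var (x : ℕ) : Expr := .cell x []

/-- The test `1 ≤ e`. -/
abbrev Test.pos (e : Expr) : Test := .le (.const 1) e

/-- The test `e₁ = e₂`. -/
def Test.eq (e₁ e₂ : Expr) : Test := .and (.le e₁ e₂) (.le e₂ e₁)

theorem Test.holds_eq {e₁ e₂ : Expr} {m : Memory} :
    (Test.eq e₁ e₂).Holds m ↔ e₁.eval m = e₂.eval m := le_antisymm_iff.symm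

/-- The test `0 ≤ x ∧ x < n` for the scalar variable `x`. -/
abbrev Test.isVertex (x : ℕ) : Test :=
  .and (.le (.const 0) (.var x)) (.le (.add (.var x) (.const 1)) (.var 0))

open Cmd

/-! The variables of the algorithm are: `0` the number `n` of vertices; `1` the adjacency matrix;
`2` the output; `3` the tables, where `3[t, s, d, w]` is `1` if the table `t` admits `s`, `d`, `w`;
`4` which vertices remain; `5` the number of the table of a vertex; `6` the number of tables; and
scratch variables. -/

/-- Fill in the tables of the vertices. -/
def initTables : Cmd :=
  ranges [9, 11, 13] (.ite (.and (.isVertex 9) (.and (.le (.const (-1)) (.var 11))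
    (.and (.le (.var 11) (.const 1)) (.pos (.add (.var 11) (.var 13))))))
    (.assign 3 [9, 11, 13, 11] (.const 1)) .skip)

/-- Let all vertices remain. -/
def initVertices : Cmd :=
  .range 9 (.ite (.isVertex 9) (.seq (.assign 4 [9] (.const 1)) (.assign 5 [9] (.var 9))) .skip)

/-- Set the variable `17` to `1` if the vertices `8` and `9` are twins, and otherwise to `0`; set
`18` to `1` if `9` has no neighbour other than `8`, and otherwise to `0`. -/
def checkPair : Cmd :=
  .seq (.assign 17 [] (.const 1)) (.seq (.assign 18 [] (.const 1))
    (.range 10 (.ite (.and (.pos (.cell 4 [10])) (.and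
      (.not (.eq (.var 10) (.var 8)))
      (.not (.eq (.var 10) (.var 9)))))
      (.seq
        (.ite (.pos (.cell 1 [10, 9])) (.assign 18 [] (.const 0)) .skip)
        (.ite (.eq (.cell 1 [10, 8]) (.cell 1 [10, 9])) .skip (.assign 17 [] (.const 0))))
      .skip)))

/-- `x := b * y` for scalar variables, where `b` is `0` or `1`. -/
def mulBit (x b y : ℕ) : Cmd :=
  .ite (.pos (.var b)) (.assign x [] (.var y)) (.assign x [] (.const 0))

/-- Add an entry to the table `6`, if it arises from entries of the tables `19` and `20`. -/
def mergeEntry : Cmd :=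
  .seq (mulBit 21 16 12) (.seq (.assign 21 [] (.add (.var 21) (.var 13)))
  (.seq (mulBit 22 16 11) (.seq (mulBit 23 17 13) (.seq (.assign 22 [] (.add (.var 22) (.var 23)))
  (.seq (mulBit 23 17 12) (.seq (.assign 23 [] (.add (.var 23) (.var 11)))
  (.seq (.assign 24 [] (.add (.var 14) (.var 15)))
  (.ite (.and (.pos (.cell 3 [19, 11, 21, 14])) (.pos (.cell 3 [20, 12, 22, 15])))
    (.assign 3 [6, 23, 13, 24] (.const 1)) .skip))))))))

/-- Remove the vertex `9`, after merging it into `8`. -/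
def mergePair : Cmd :=
  .seq (.assign 19 [] (.cell 5 [8])) (.seq (.assign 20 [] (.cell 5 [9]))
    (.seq (ranges [11, 12, 13, 14, 15] mergeEntry)
    (.seq (.assign 5 [8] (.var 6)) (.seq (.assign 4 [9] (.const 0))
    (.assign 6 [] (.add (.var 6) (.const 1)))))))

/-- Merge the vertices `8` and `9`, if possible. -/
def reducePair : Cmd :=
  .ite (.and (.pos (.cell 4 [8])) (.and (.pos (.cell 4 [9]))
      (.not (.eq (.var 8) (.var 9)))))
    (.seq (.assign 16 [] (.cell 1 [8, 9])) (.seq checkPair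
      (.ite (.pos (.add (.var 17) (.var 18))) mergePair .skip))) .skip

/-- Find the least weight. -/
def findMinimum : Cmd :=
  .seq (.assign 2 [] (.var 0)) (.seq (.assign 25 [] (.const 0))
    (ranges [9, 11, 14] (.ite (.pos (.cell 4 [9])) (.seq (.assign 19 [] (.cell 5 [9]))
      (.ite (.and (.pos (.cell 3 [19, 11, 25, 14])) (.le (.var 14) (.var 2)))
        (.assign 2 [] (.var 14)) .skip)) .skip)))

/-- The algorithm. -/
def algorithm : Cmd :=
  .seq (.seq initTables (.seq initVertices (.assign 6 [] (.var 0))))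
    (.seq (.range 7 (ranges [8, 9] reducePair)) findMinimum)

theorem wellFormed_algorithm : algorithm.wellFormed = true := rfl

/-! ### Correctness of the algorithm -/

variable {n : ℕ} (G : SimpleGraph (Fin n))

/-- The remaining vertices. -/
def remaining (n : ℕ) (m : Memory) : Finset (Fin n) :=
  Finset.univ.filter fun i => 1 ≤ m 4 [((i : ℕ) : ℤ)]

theorem mem_remaining {m : Memory} {i : Fin n} :
    i ∈ remaining n m ↔ 1 ≤ m 4 [((i : ℕ) : ℤ)] := by simp [remaining]

/-- The constraint on the vertex `i` that is stored in its table. -/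
def tableConstraint (m : Memory) (i : Fin n) (s d w : ℤ) : Prop :=
  1 ≤ m 3 [m 5 [((i : ℕ) : ℤ)], s, d, w]

/-- The invariant of the main loop. -/
structure Invariant (m : Memory) : Prop where
  size : m 0 [] = n
  adj : ∀ i j : Fin n, m 1 [((i : ℕ) : ℤ), ((j : ℕ) : ℤ)] = adjEntry G i j
  vertex : ∀ z : ℤ, 1 ≤ m 4 [z] → ∃ i : Fin n, z = (i : ℕ)
  table : ∀ i ∈ remaining n m, m 5 [((i : ℕ) : ℤ)] < m 6 []
  fresh : ∀ t l, m 6 [] ≤ t → m 3 (t :: l) = 0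
  represents : Represents G (remaining n m) (tableConstraint m)

variable {G}

theorem Invariant.congr {m m' : Memory} (h : Invariant G m)
    (h' : ∀ x ∈ [0, 1, 3, 4, 5, 6], m' x = m x) : Invariant G m' := by
  simp only [List.forall_mem_cons] at h'
  obtain ⟨h0, h1, h3, h4, h5, h6, -⟩ := h'
  have hr : remaining n m' = remaining n m := by simp [remaining, h4]
  have ht : tableConstraint (n := n) m' = tableConstraint m := by
    funext i s d w; simp [tableConstraint, h3, h5]
  constructor
  · rw [h0]; exact h.size
  · rw [h1]; exact h.adj
  · rw [h4]; exact h.vertex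
  · rw [hr, h5, h6]; exact h.table
  · rw [h3, h6]; exact h.fresh
  · rw [hr, ht]; exact h.represents

theorem adjEntry_eq_zero_or_one {V : Type*} (G : SimpleGraph V) (x y : V) :
    adjEntry G x y = 0 ∨ adjEntry G x y = 1 := by
  unfold adjEntry; split_ifs <;> simp

/-- The vertex `v` can be merged into `u`. -/
def IsMergeable {V : Type*} (G : SimpleGraph V) (S : Finset V) (u v : V) : Prop :=
  (∀ x ∈ S, x ≠ u → x ≠ v → adjEntry G x u = adjEntry G x v) ∨
    ∀ x ∈ S, x ≠ u → x ≠ v → adjEntry G x v = 0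

theorem cast_ne {n : ℕ} {x y : Fin n} (h : x ≠ y) : ((x : ℕ) : ℤ) ≠ ((y : ℕ) : ℤ) :=
  fun h' => h (Fin.ext (by exact_mod_cast h'))

/-- The invariant says that a flag is `0` only if its condition fails; the effect says that each
violating vertex sets the flag to `0`. -/
theorem denote_checkPair {m : Memory} (h : Invariant G m) {u v : Fin n}
    (hu : m 8 [] = (u : ℕ)) (hv : m 9 [] = (v : ℕ)) :
    (((checkPair.denote n m) 17 [] = 1 ∧
        ∀ x ∈ remaining n m, x ≠ u → x ≠ v → adjEntry G x u = adjEntry G x v) ∨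
      ((checkPair.denote n m) 17 [] = 0 ∧
        ¬ ∀ x ∈ remaining n m, x ≠ u → x ≠ v → adjEntry G x u = adjEntry G x v)) ∧
    (((checkPair.denote n m) 18 [] = 1 ∧
        ∀ x ∈ remaining n m, x ≠ u → x ≠ v → adjEntry G x v = 0) ∨
      ((checkPair.denote n m) 18 [] = 0 ∧
        ¬ ∀ x ∈ remaining n m, x ≠ u → x ≠ v → adjEntry G x v = 0)) := by
  rw [checkPair, denote, denote]
  generalize hc : Cmd.ite _ _ _ = c
  simp only [denote]
  have hstep : ∀ m' : Memory, (∀ y ∈ [1, 4, 8, 9], m' y = m y) →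
      ((∃ x ∈ remaining n m, x ≠ u ∧ x ≠ v ∧ m' 10 [] = (x : ℕ) ∧
        (c.denote n m' 17 [] = if adjEntry G x u = adjEntry G x v then m' 17 [] else 0) ∧
        (c.denote n m' 18 [] = if adjEntry G x v = 0 then m' 18 [] else 0)) ∨
      ((∀ x ∈ remaining n m, x ≠ u → x ≠ v → m' 10 [] ≠ (x : ℕ)) ∧
        c.denote n m' 17 [] = m' 17 [] ∧ c.denote n m' 18 [] = m' 18 [])) := by
    intro m' hm'
    simp only [List.forall_mem_cons] at hm'
    obtain ⟨h1, h4, h8, h9, -⟩ := hm'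
    subst hc
    by_cases hx : 1 ≤ m 4 [m' 10 []] ∧ m' 10 [] ≠ m 8 [] ∧ m' 10 [] ≠ m 9 []
    · left
      obtain ⟨hx1, hx2, hx3⟩ := hx
      obtain ⟨x, hx⟩ := h.vertex _ hx1
      rw [hx] at hx1 hx2 hx3
      refine ⟨x, mem_remaining.2 hx1, fun e => hx2 (by rw [hu, e]), fun e => hx3 (by rw [hv, e]),
        hx, ?_⟩
      have e1 := h.adj x u
      have e2 := h.adj x v
      have c1 := adjEntry_eq_zero_or_one G x u
      have c2 := adjEntry_eq_zero_or_one G x v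
      rw [hu] at hx2
      rw [hv] at hx3
      rcases c1 with c1 | c1 <;> rcases c2 with c2 | c2 <;>
        simp [denote_skip, denote_seq, denote_assign_apply, denote_ite_apply, Test.Holds, Expr.eval,
          Memory.address, Test.holds_eq, h1, h4, h8, h9, hu, hv, hx, hx1, hx2, hx3, e1, e2, c1, c2]
    · right
      constructor
      · intro x hxS hxu hxv hx'
        refine hx ⟨by rw [hx']; exact mem_remaining.1 hxS, ?_, ?_⟩
        · rw [hx', hu]; exact cast_ne hxu
        · rw [hx', hv]; exact cast_ne hxv
      · rw [denote, if_neg]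
        · simp [denote]
        · simpa only [Test.Holds, Test.holds_eq, Expr.eval, Memory.address, List.map_cons,
            List.map_nil, h4, h8, h9] using hx
  have hw : ∀ y ∈ [1, 4, 8, 9, 10], c.writes y = false := by subst hc; decide
  set P := ∀ x ∈ remaining n m, x ≠ u → x ≠ v → adjEntry G x u = adjEntry G x v
  set Q := ∀ x ∈ remaining n m, x ≠ u → x ≠ v → adjEntry G x v = 0
  have key := denote_range (n := n) (x := 10) (c := c) (hw 10 (by simp))
    (J := fun m' => (∀ y ∈ [1, 4, 8, 9], m' y = m y) ∧ (m' 17 [] = 1 ∨ m' 17 [] = 0 ∧ ¬ P) ∧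
      (m' 18 [] = 1 ∨ m' 18 [] = 0 ∧ ¬ Q))
    (E := fun i m' => ∀ x ∈ remaining n m, x ≠ u → x ≠ v → i = (x : ℕ) →
      (adjEntry G x u ≠ adjEntry G x v → m' 17 [] = 0) ∧ (adjEntry G x v ≠ 0 → m' 18 [] = 0))
    (fun m' z hm' => ⟨fun y hy => by
      rw [← hm'.1 y hy]; funext a; exact Memory.write_of_ne (by rintro rfl; simp at hy) _ _ _,
      by rw [Memory.write_of_ne (by simp), Memory.write_of_ne (by simp)]; exact hm'.2⟩)
    (fun i m' z hm' => by
      rw [Memory.write_of_ne (by simp), Memory.write_of_ne (by simp)]; exact hm')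
    (fun m' hm' _ => by
      refine ⟨⟨fun y hy => ?_, ?_⟩, ?_⟩
      · rw [denote_of_not_writes (hw y (by simp at hy ⊢; tauto)), hm'.1 y hy]
      · rcases hstep m' hm'.1 with ⟨x, hx, hxu, hxv, -, h1, h2⟩ | ⟨-, h1, h2⟩
        · rw [h1, h2]
          split_ifs with h3 h4 h4
          · exact hm'.2
          · exact ⟨hm'.2.1, Or.inr ⟨rfl, fun h => h4 (h x hx hxu hxv)⟩⟩
          · exact ⟨Or.inr ⟨rfl, fun h => h3 (h x hx hxu hxv)⟩, hm'.2.2⟩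
          · exact ⟨Or.inr ⟨rfl, fun h => h3 (h x hx hxu hxv)⟩,
              Or.inr ⟨rfl, fun h => h4 (h x hx hxu hxv)⟩⟩
        · rw [h1, h2]; exact hm'.2
      · intro x hx hxu hxv hxi
        rcases hstep m' hm'.1 with ⟨y, hy, hyu, hyv, hyi, h1, h2⟩ | ⟨h0, -, -⟩
        · obtain rfl : x = y := by
            by_contra hxy; exact cast_ne hxy (hxi.symm.trans hyi)
          rw [h1, h2]
          exact ⟨fun h => if_neg h, fun h => if_neg h⟩
        · exact absurd hxi (h0 x hx hxu hxv))
    (fun i m' _ hm' _ hE x hx hxu hxv hxi => by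
      obtain ⟨hE1, hE2⟩ := hE x hx hxu hxv hxi
      rcases hstep m' hm'.1 with ⟨y, hy, hyu, hyv, -, h1, h2⟩ | ⟨-, h1, h2⟩
      · rw [h1, h2]
        exact ⟨fun h => by rw [hE1 h, ite_self], fun h => by rw [hE2 h, ite_self]⟩
      · rw [h1, h2]; exact ⟨hE1, hE2⟩)
    (m := (m.write 17 (m.address []) 1).write 18 [] 1)
    ⟨fun y hy => by
      funext a
      rw [Memory.write_of_ne (by rintro rfl; simp at hy),
        Memory.write_of_ne (by rintro rfl; simp at hy)],
      Or.inl (by simp [Memory.write, Memory.address]), Or.inl (by simp [Memory.write])⟩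
  obtain ⟨⟨-, h17, h18⟩, hE⟩ := key
  have hE' := fun x : Fin n => hE (x : ℕ) (by rw [abs_of_nonneg] <;> omega)
  refine ⟨h17.imp_left fun h => ⟨h, fun x hx hxu hxv => ?_⟩,
    h18.imp_left fun h => ⟨h, fun x hx hxu hxv => ?_⟩⟩
  · by_contra hne
    have := (hE' x x hx hxu hxv rfl).1 hne
    exact zero_ne_one (this.symm.trans h)
  · by_contra hne
    have := (hE' x x hx hxu hxv rfl).2 hne
    exact zero_ne_one (this.symm.trans h)

open Classical in
theorem denote_mergeEntry {m : Memory} (ha : m 16 [] = 0 ∨ m 16 [] = 1)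
    (hb : m 17 [] = 0 ∨ m 17 [] = 1) (l : List ℤ) :
    mergeEntry.denote n m 3 l =
      if (1 ≤ m 3 [m 19 [], m 11 [], m 13 [] + m 16 [] * m 12 [], m 14 []] ∧
        1 ≤ m 3 [m 20 [], m 12 [], m 17 [] * m 13 [] + m 16 [] * m 11 [], m 15 []]) ∧
        l = [m 6 [], m 11 [] + m 17 [] * m 12 [], m 13 [], m 14 [] + m 15 []] then 1
      else m 3 l := by
  rcases ha with ha | ha <;> rcases hb with hb | hb <;>
  simp [mergeEntry, mulBit, denote_skip, denote_seq, denote_assign_apply, denote_ite_apply,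
    Test.Holds, Expr.eval, Memory.address, ha, hb, add_comm, ite_and]

/-- Soundness of the new entries is part of the invariant, completeness is the effect. The target
table starts empty and differs from both sources, so the loops always read original entries. -/
theorem denote_mergeTable {m : Memory} (ha : m 16 [] = 0 ∨ m 16 [] = 1)
    (hb : m 17 [] = 0 ∨ m 17 [] = 1) (hp : m 19 [] ≠ m 6 []) (hq : m 20 [] ≠ m 6 [])
    (h0 : ∀ l, m 3 (m 6 [] :: l) = 0) :
    (∀ t l, t ≠ m 6 [] →
      (ranges [11, 12, 13, 14, 15] mergeEntry).denote n m 3 (t :: l) = m 3 (t :: l)) ∧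
    ∀ s d w, 1 ≤ (ranges [11, 12, 13, 14, 15] mergeEntry).denote n m 3 [m 6 [], s, d, w] ↔
      mergedConstraint n (m 16 []) (m 17 []) (fun s d w => 1 ≤ m 3 [m 19 [], s, d, w])
        (fun s d w => 1 ≤ m 3 [m 20 [], s, d, w]) s d w := by
  have hw : ∀ y ∈ [6, 16, 17, 19, 20, 11, 12, 13, 14, 15], mergeEntry.writes y = false := by decide
  have key := denote_ranges (n := n) (xs := [11, 12, 13, 14, 15]) (c := mergeEntry) (by decide)
    (by decide)
    (J := fun m' => (∀ y ∈ [6, 16, 17, 19, 20], m' y = m y) ∧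
      (∀ t l, t ≠ m 6 [] → m' 3 (t :: l) = m 3 (t :: l)) ∧
      ∀ s d w, 1 ≤ m' 3 [m 6 [], s, d, w] →
        mergedConstraint n (m 16 []) (m 17 []) (fun s d w => 1 ≤ m 3 [m 19 [], s, d, w])
          (fun s d w => 1 ≤ m 3 [m 20 [], s, d, w]) s d w)
    (E := fun l m' => ∀ s₁ s₂ d w₁ w₂, l = [s₁, s₂, d, w₁, w₂] →
      1 ≤ m 3 [m 19 [], s₁, d + m 16 [] * s₂, w₁] →
      1 ≤ m 3 [m 20 [], s₂, m 17 [] * d + m 16 [] * s₁, w₂] →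
      1 ≤ m' 3 [m 6 [], s₁ + m 17 [] * s₂, d, w₁ + w₂])
    (fun x hx m' z hm' => by
      have h3 : (3 : ℕ) ≠ x := by rintro rfl; simp at hx
      simp only [Memory.write_of_ne h3]
      refine ⟨fun y hy => ?_, hm'.2⟩
      rw [← hm'.1 y hy]; funext a
      refine Memory.write_of_ne ?_ _ _ _
      rintro rfl; simp at hx hy; omega)
    (fun x hx l m' z hm' => by
      have h3 : (3 : ℕ) ≠ x := by rintro rfl; simp at hx
      simp only [Memory.write_of_ne h3]
      exact hm')
    (fun m' hm' hr => by
      obtain ⟨h1, h2, h3⟩ := hm'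
      have h1' := h1
      simp only [List.forall_mem_cons] at h1'
      obtain ⟨h6, h16, h17, h19, h20, -⟩ := h1'
      have hval := denote_mergeEntry (n := n) (m := m') (by rwa [h16]) (by rwa [h17])
      simp only [h6, h16, h17, h19, h20, h2 _ _ hp, h2 _ _ hq] at hval
      simp only [List.forall_mem_cons] at hr
      refine ⟨⟨fun y hy => ?_, fun t l ht => ?_, fun s d w h => ?_⟩, ?_⟩
      · rw [denote_of_not_writes (hw y (by simp at hy ⊢; tauto)), h1 y hy]
      · rw [hval, if_neg, h2 t l ht]
        rintro ⟨-, h⟩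
        exact ht (List.cons.inj h).1
      · rw [hval] at h
        split_ifs at h with hc
        · obtain ⟨hc, hl⟩ := hc
          simp only [List.cons.injEq, true_and, and_true] at hl
          obtain ⟨rfl, rfl, rfl⟩ := hl
          exact ⟨_, _, _, _, hr.1, hr.2.1, hr.2.2.1, hr.2.2.2.1, hr.2.2.2.2.1, rfl, rfl, hc⟩
        · exact h3 s d w h
      · intro s₁ s₂ d w₁ w₂ hl hu hv
        simp only [List.map_cons, List.map_nil, List.cons.injEq, and_true] at hl
        obtain ⟨rfl, rfl, rfl, rfl, rfl⟩ := hl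
        rw [hval, if_pos ⟨⟨hu, hv⟩, rfl⟩])
    (fun l m' hm' _ hE s₁ s₂ d w₁ w₂ hl hu hv => by
      obtain ⟨h1, h2, h3⟩ := hm'
      simp only [List.forall_mem_cons] at h1
      rw [denote_mergeEntry (by rw [h1.2.1]; exact ha) (by rw [h1.2.2.1]; exact hb)]
      split_ifs
      exacts [le_rfl, hE _ _ _ _ _ hl hu hv])
    (m := m) ⟨fun _ _ => rfl, fun _ _ _ => rfl, fun s d w h => by rw [h0] at h; omega⟩
  obtain ⟨⟨-, h2, h3⟩, hE⟩ := key
  refine ⟨h2, fun s d w => ⟨h3 s d w, ?_⟩⟩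
  rintro ⟨s₁, s₂, w₁, w₂, b1, b2, b3, b4, b5, rfl, rfl, hu, hv⟩
  exact hE [s₁, s₂, d, w₁, w₂] rfl (by simp [b1, b2, b3, b4, b5]) _ _ _ _ _ rfl hu hv

/-- The new table gets an unused number, so the tables of the other vertices survive and
`Represents.merge` applies. -/
theorem Invariant.denote_mergePair {m : Memory} (h : Invariant G m) {u v : Fin n}
    (hu : m 8 [] = (u : ℕ)) (hv : m 9 [] = (v : ℕ)) (huS : u ∈ remaining n m)
    (hvS : v ∈ remaining n m) (huv : u ≠ v) (ha : m 16 [] = adjEntry G u v)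
    (hb : m 17 [] = 0 ∨ m 17 [] = 1)
    (hN : ∀ x ∈ remaining n m, x ≠ u → x ≠ v → adjEntry G x v = m 17 [] * adjEntry G x u) :
    Invariant G (mergePair.denote n m) ∧
      remaining n (mergePair.denote n m) = (remaining n m).erase v := by
  set m₁ := (Cmd.assign 20 [] (.cell 5 [9])).denote n ((Cmd.assign 19 [] (.cell 5 [8])).denote n m)
    with hm₁
  have e₁ : ∀ y, y ≠ 19 → y ≠ 20 → m₁ y = m y := fun y h19 h20 => by
    rw [hm₁, denote_of_not_writes (by simpa [writes] using h20),
      denote_of_not_writes (by simpa [writes] using h19)]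
  have e19 : m₁ 19 [] = m 5 [((u : ℕ) : ℤ)] := by
    simp [hm₁, denote_assign_apply, Expr.eval, Memory.address, hu]
  have e20 : m₁ 20 [] = m 5 [((v : ℕ) : ℤ)] := by
    simp [hm₁, denote_assign_apply, Expr.eval, Memory.address, hv]
  have e6 := e₁ 6 (by simp) (by simp)
  have e3 := e₁ 3 (by simp) (by simp)
  have e16 := e₁ 16 (by simp) (by simp)
  have e17 := e₁ 17 (by simp) (by simp)
  obtain ⟨hT, hC⟩ := denote_mergeTable (n := n) (m := m₁)
    (by rw [e16, ha]; exact adjEntry_eq_zero_or_one G u v) (by rw [e17]; exact hb)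
    (by rw [e19, e6]; exact (h.table u huS).ne) (by rw [e20, e6]; exact (h.table v hvS).ne)
    (fun l => by rw [e3, e6]; exact h.fresh _ _ le_rfl)
  set m₂ := (ranges [11, 12, 13, 14, 15] mergeEntry).denote n m₁ with hm₂
  have e₂ : ∀ y ∈ [0, 1, 4, 5, 6, 8, 9], m₂ y = m y := fun y hy => by
    have : ∀ y ∈ [0, 1, 4, 5, 6, 8, 9],
      (ranges [11, 12, 13, 14, 15] mergeEntry).writes y = false := by decide
    rw [hm₂, denote_of_not_writes (this y hy),
      e₁ y (by rintro rfl; simp at hy) (by rintro rfl; simp at hy)]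
  simp only [List.forall_mem_cons] at e₂
  obtain ⟨f0, f1, f4, f5, f6, f8, f9, -⟩ := e₂
  have hden : mergePair.denote n m = (Cmd.assign 6 [] (.add (.var 6) (.const 1))).denote n
    ((Cmd.assign 4 [9] (.const 0)).denote n ((Cmd.assign 5 [8] (.var 6)).denote n m₂)) := rfl
  set m₃ := mergePair.denote n m
  have g0 : m₃ 0 [] = m 0 [] := by rw [hden]; simp [denote_assign_apply, f0]
  have g1 : m₃ 1 = m 1 := by rw [hden]; funext l; simp [denote_assign_apply, f1]
  have g3 : m₃ 3 = m₂ 3 := by rw [hden]; funext l; simp [denote_assign_apply]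
  have g4 : ∀ z : ℤ, m₃ 4 [z] = if z = (v : ℕ) then 0 else m 4 [z] := fun z => by
    rw [hden]; simp [denote_assign_apply, Expr.eval, f4, f9, hv]
  have g5 : ∀ z : ℤ, m₃ 5 [z] = if z = (u : ℕ) then m 6 [] else m 5 [z] := fun z => by
    rw [hden]; simp [denote_assign_apply, Expr.eval, Memory.address, f5, f6, f8, hu]
  have g6 : m₃ 6 [] = m 6 [] + 1 := by
    rw [hden]; simp [denote_assign_apply, Expr.eval, Memory.address, f6]
  have hrem : remaining n m₃ = (remaining n m).erase v := by
    ext i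
    rw [Finset.mem_erase, mem_remaining, mem_remaining, g4]
    by_cases hiv : i = v
    · simp [hiv]
    · rw [if_neg (cast_ne hiv)]; simp [hiv]
  have old : ∀ i ∈ remaining n m, ∀ l, m₂ 3 (m 5 [((i : ℕ) : ℤ)] :: l) =
      m 3 (m 5 [((i : ℕ) : ℤ)] :: l) := fun i hi l => by
    rw [hT _ _ (by rw [e6]; exact (h.table i hi).ne), e3]
  refine ⟨⟨by rw [g0, h.size], by rw [g1]; exact h.adj, fun z hz => ?_, fun i hi => ?_,
    fun t l ht => ?_, ?_⟩, hrem⟩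
  · rw [g4] at hz
    split_ifs at hz with hzv
    · omega
    · exact h.vertex z hz
  · rw [hrem] at hi
    have := h.table i (Finset.mem_of_mem_erase hi)
    rw [g5, g6]
    split_ifs <;> omega
  · rw [g6] at ht
    rw [g3, hT _ _ (by rw [e6]; omega), e3]
    exact h.fresh t l (by omega)
  · rw [hrem]
    refine h.represents.merge huS hvS huv (b := m 17 []) (by rcases hb with hb | hb <;> simp [hb])
      hN
      (fun x hxS hxu hxv s d w => ?_) (fun s d w => ?_)
    · rw [tableConstraint, tableConstraint, g3, g5, if_neg (cast_ne hxu), old x hxS]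
    · rw [tableConstraint, g3, g5, if_pos rfl, ← e6, hC, e16, e17, ha, e19, e20, Fintype.card_fin]
      simp only [e3]
      exact Iff.rfl

theorem Invariant.denote_reducePair {m : Memory} (h : Invariant G m) :
    Invariant G (reducePair.denote n m) ∧
      remaining n (reducePair.denote n m) ⊆ remaining n m ∧
      ∀ u v : Fin n, m 8 [] = (u : ℕ) → m 9 [] = (v : ℕ) → u ∈ remaining n m →
        v ∈ remaining n m → u ≠ v → IsMergeable G (remaining n m) u v →
        remaining n (reducePair.denote n m) ≠ remaining n m := by
  rw [reducePair, denote]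
  simp only [Test.Holds, Test.holds_eq, Expr.eval, Memory.address, List.map_cons, List.map_nil]
  split_ifs with hif
  swap
  · refine ⟨h, subset_rfl, fun u v hu hv huS hvS huv _ => absurd ⟨?_, ?_, ?_⟩ hif⟩
    · rw [hu]; exact mem_remaining.1 huS
    · rw [hv]; exact mem_remaining.1 hvS
    · rw [hu, hv]; exact cast_ne huv
  obtain ⟨h8, h9, hne⟩ := hif
  obtain ⟨u, hu⟩ := h.vertex _ h8
  obtain ⟨v, hv⟩ := h.vertex _ h9
  have huS : u ∈ remaining n m := mem_remaining.2 (hu ▸ h8)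
  have hvS : v ∈ remaining n m := mem_remaining.2 (hv ▸ h9)
  have huv : u ≠ v := fun e => hne (by rw [hu, hv, e])
  rw [denote_seq, denote_seq]
  set m₁ := (Cmd.assign 16 [] (.cell 1 [8, 9])).denote n m with hm₁
  have e₁ : ∀ y, y ≠ 16 → m₁ y = m y := fun y hy => by
    rw [hm₁, denote_of_not_writes (by simpa [writes] using hy)]
  have e16 : m₁ 16 [] = adjEntry G u v := by
    simp [hm₁, denote_assign_apply, Expr.eval, Memory.address, hu, hv, h.adj]
  have hI₁ : Invariant G m₁ := h.congr fun y hy => e₁ y (by rintro rfl; simp at hy)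
  have hr₁ : remaining n m₁ = remaining n m := by simp [remaining, e₁ 4 (by simp)]
  obtain ⟨h17, h18⟩ := denote_checkPair hI₁ (by rw [e₁ 8 (by simp), hu])
    (by rw [e₁ 9 (by simp), hv])
  set m₂ := checkPair.denote n m₁ with hm₂
  have e₂ : ∀ y ∈ [0, 1, 3, 4, 5, 6, 8, 9, 16], m₂ y = m₁ y := by
    have : ∀ y ∈ [0, 1, 3, 4, 5, 6, 8, 9, 16], checkPair.writes y = false := by decide
    exact fun y hy => denote_of_not_writes (this y hy) _
  have hI₂ : Invariant G m₂ := hI₁.congr fun y hy => e₂ y (by simp at hy ⊢; tauto)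
  have hr₂ : remaining n m₂ = remaining n m := by
    rw [← hr₁]; simp [remaining, e₂ 4 (by simp)]
  rw [hr₁] at h17 h18
  rw [denote]
  simp only [Test.Holds, Expr.eval, Memory.address, List.map_nil]
  split_ifs with hif
  · have hmain := hI₂.denote_mergePair (u := u) (v := v)
      (by rw [e₂ 8 (by simp), e₁ 8 (by simp), hu]) (by rw [e₂ 9 (by simp), e₁ 9 (by simp), hv])
      (by rwa [hr₂]) (by rwa [hr₂]) huv (by rw [e₂ 16 (by simp), e16])
      -- The twin flag `17` doubles as `b`. If it is `0`, the test guarantees that flag `18` is `1`,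
      -- so `v` has no remaining neighbour other than `u`.
      (by rcases h17 with h17 | h17; exacts [Or.inr h17.1, Or.inl h17.1]) (by
        rw [hr₂]
        rcases h17 with h17 | h17
        · rw [h17.1]; simpa [eq_comm] using h17.2
        · rw [h17.1]
          rcases h18 with h18 | h18
          · simpa using h18.2
          · rw [h17.1, h18.1] at hif; omega)
    rw [hr₂] at hmain
    refine ⟨hmain.1, by rw [hmain.2]; exact Finset.erase_subset _ _, fun _ _ _ _ _ _ _ _ => ?_⟩
    rw [hmain.2]
    exact fun e => (Finset.erase_eq_self.1 e) hvS
  · refine ⟨hI₂, by rw [denote_skip, hr₂], fun u' v' hu' hv' _ _ _ hm => absurd ?_ hif⟩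
    obtain rfl : u' = u := by by_contra e; exact cast_ne e (hu'.symm.trans hu)
    obtain rfl : v' = v := by by_contra e; exact cast_ne e (hv'.symm.trans hv)
    rcases hm with hm | hm
    · rcases h17 with h17 | h17
      · rcases h18 with h18 | h18 <;> rw [h17.1, h18.1] <;> simp
      · exact absurd hm h17.2
    · rcases h18 with h18 | h18
      · rcases h17 with h17 | h17 <;> rw [h17.1, h18.1] <;> simp
      · exact absurd hm h18.2

theorem Invariant.write {m : Memory} (h : Invariant G m) {x : ℕ} (hx : 7 ≤ x) (a : List ℤ) (z : ℤ) :
    Invariant G (m.write x a z) :=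
  h.congr fun y hy => funext fun b => Memory.write_of_ne (by simp at hy; omega) _ _ _

theorem remaining_write {m : Memory} {x : ℕ} (hx : x ≠ 4) (a : List ℤ) (z : ℤ) :
    remaining n (m.write x a z) = remaining n m := by
  simp only [remaining, Memory.write_of_ne hx.symm]

theorem IsDistanceHereditary.exists_isMergeable (hG : IsDistanceHereditary G) {S : Finset (Fin n)}
    (hS : 2 ≤ S.card) : ∃ u ∈ S, ∃ v ∈ S, u ≠ v ∧ IsMergeable G S u v := by
  obtain ⟨u, hu, v, hv, huv, h⟩ := hG.exists_isRemovable_induce S hS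
  refine ⟨u, hu, v, hv, huv, h.imp (fun h x hx hxu hxv => ?_) fun h x hx hxu hxv => ?_⟩
  · classical exact if_congr (h x hx hxu hxv) rfl rfl
  · exact if_neg (h x hx hxu hxv)

/-- Some pair is mergeable at the start. If nothing has been removed when its turn comes, it is
merged then; as the remaining set only shrinks, a loss is never undone. -/
theorem Invariant.denote_pass (hG : IsDistanceHereditary G) {m : Memory} (h : Invariant G m) :
    Invariant G ((ranges [8, 9] reducePair).denote n m) ∧
      ((remaining n ((ranges [8, 9] reducePair).denote n m)).card ≤ 1 ∨
      (remaining n ((ranges [8, 9] reducePair).denote n m)).card + 1 ≤ (remaining n m).card) := by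
  obtain ⟨⟨hI, hsub⟩, hE⟩ := denote_ranges (n := n) (xs := [8, 9]) (c := reducePair) (by decide)
    (by decide)
    (J := fun m' => Invariant G m' ∧ remaining n m' ⊆ remaining n m)
    (E := fun l m' => ∀ u ∈ remaining n m, ∀ v ∈ remaining n m, l = [((u : ℕ) : ℤ), ((v : ℕ) : ℤ)] →
      u ≠ v → IsMergeable G (remaining n m) u v → remaining n m' ≠ remaining n m)
    (fun x hx m' z hm' => by
      have hx : 7 ≤ x ∧ x ≠ 4 := by simp at hx; omega
      exact ⟨hm'.1.write hx.1 _ _, by rw [remaining_write hx.2]; exact hm'.2⟩)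
    (fun x hx l m' z hm' => by
      have hx : x ≠ 4 := by simp at hx; omega
      rw [remaining_write hx]; exact hm')
    (fun m' hm' _ => by
      obtain ⟨h1, h2, h3⟩ := hm'.1.denote_reducePair
      refine ⟨⟨h1, h2.trans hm'.2⟩, fun u hu v hv hl huv hm heq => ?_⟩
      simp only [List.map_cons, List.map_nil, List.cons.injEq, and_true] at hl
      have heq' : remaining n m' = remaining n m := hm'.2.antisymm (heq ▸ h2)
      rw [heq'] at h3
      exact h3 u v hl.1 hl.2 hu hv huv hm heq)
    (fun l m' hm' _ hE u hu v hv hl huv hm heq =>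
      hE u hu v hv hl huv hm (hm'.2.antisymm (heq ▸ hm'.1.denote_reducePair.2.1)))
    (m := m) ⟨h, subset_rfl⟩
  refine ⟨hI, ?_⟩
  by_cases hcard : 2 ≤ (remaining n m).card
  · right
    obtain ⟨u, hu, v, hv, huv, hm⟩ := hG.exists_isMergeable hcard
    have hne := hE [((u : ℕ) : ℤ), ((v : ℕ) : ℤ)] rfl
      (by simp only [List.forall_mem_cons, Nat.abs_cast, List.not_mem_nil, false_imp_iff,
            implies_true, and_true]
          omega) u hu v hv rfl huv hm
    exact Finset.card_lt_card (hsub.ssubset_of_ne hne)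
  · left
    have := Finset.card_le_card hsub
    omega

theorem Invariant.denote_mainLoop (hG : IsDistanceHereditary G) {m : Memory} (h : Invariant G m) :
    Invariant G ((Cmd.range 7 (ranges [8, 9] reducePair)).denote n m) ∧
      (remaining n ((Cmd.range 7 (ranges [8, 9] reducePair)).denote n m)).card ≤ 1 := by
  -- At loop value `i`, exactly `i + n` passes are complete. After `2 * n + 1` passes the second
  -- alternative would make the cardinality negative.
  have := denote_range_induction (n := n) (x := 7) (c := ranges [8, 9] reducePair) (by decide)
    (fun i m => Invariant G m ∧
      ((remaining n m).card ≤ 1 ∨ ((remaining n m).card : ℤ) + (i + n) ≤ n)) (m := m)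
    ⟨h.write (by simp) _ _, Or.inr (by
      have := Finset.card_le_univ (remaining n (m.write 7 [] (-n)))
      rw [Fintype.card_fin] at this
      omega)⟩ (by
      rintro i m - - ⟨h1, h2⟩
      obtain ⟨h3, h4⟩ := h1.denote_pass hG
      refine ⟨h3.write (by simp) _ _, ?_⟩
      rw [remaining_write (by simp)]
      omega)
  refine ⟨this.1, ?_⟩
  omega

theorem denote_initTables {m : Memory} (hn : m 0 [] = n) (h3 : ∀ l, m 3 l = 0) :
    (∀ t l, (initTables.denote n m) 3 (t :: l) ≠ 0 → t < n) ∧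
    ∀ i : Fin n, ∀ s d w, 1 ≤ (initTables.denote n m) 3 [((i : ℕ) : ℤ), s, d, w] ↔
      vertexConstraint n s d w := by
  rw [initTables]
  generalize hc : Cmd.ite _ _ _ = c
  have hval : ∀ (m' : Memory) l, m' 0 [] = n → (c.denote n m' 3 l =
      if (0 ≤ m' 9 [] ∧ m' 9 [] < n ∧ |m' 11 []| ≤ 1 ∧ 1 ≤ m' 11 [] + m' 13 []) ∧
        l = [m' 9 [], m' 11 [], m' 13 [], m' 11 []] then 1 else m' 3 l) := by
    intro m' l hm'
    subst hc
    simp [denote_skip, denote_assign_apply, denote_ite_apply, Test.Holds, Expr.eval, Memory.address,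
      hm', abs_le, and_assoc, ite_and]
  have hw : ∀ y ∈ [0, 9, 11, 13], c.writes y = false := by subst hc; decide
  obtain ⟨⟨-, h1⟩, h2⟩ := denote_ranges (n := n) (xs := [9, 11, 13]) (c := c) (by decide)
    (fun x hx => hw x (by simp at hx ⊢; tauto))
    (J := fun m' => m' 0 [] = n ∧ ∀ l, m' 3 l ≠ 0 → ∃ t s d w, l = [t, s, d, w] ∧ 0 ≤ t ∧ t < n ∧
      vertexConstraint n s d w)
    (E := fun l m' => ∀ (i : Fin n) (s d : ℤ), l = [((i : ℕ) : ℤ), s, d] → |s| ≤ 1 → 1 ≤ s + d →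
      1 ≤ m' 3 [((i : ℕ) : ℤ), s, d, s])
    (fun x hx m' z hm' => by
      simp only [Memory.write_of_ne (show (3 : ℕ) ≠ x by rintro rfl; simp at hx),
        Memory.write_of_ne (show (0 : ℕ) ≠ x by rintro rfl; simp at hx)]
      exact hm')
    (fun x hx l m' z hm' => by
      simp only [Memory.write_of_ne (show (3 : ℕ) ≠ x by rintro rfl; simp at hx)]
      exact hm')
    (fun m' hm' hr => by
      simp only [List.forall_mem_cons] at hr
      refine ⟨⟨by rw [denote_of_not_writes (hw 0 (by simp)), hm'.1], fun l hl => ?_⟩, ?_⟩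
      · rw [hval _ _ hm'.1] at hl
        split_ifs at hl with hif
        -- The bound on `d` comes from the range of the loop variable, not from the test.
        · exact ⟨_, _, _, _, hif.2, hif.1.1, hif.1.2.1, hif.1.2.2.1, hif.1.2.2.2, rfl, hr.2.2.1⟩
        · exact hm'.2 l hl
      · intro i s d hl hs hsd
        simp only [List.map_cons, List.map_nil, List.cons.injEq, and_true] at hl
        obtain ⟨h9, rfl, rfl⟩ := hl
        rw [hval _ _ hm'.1, if_pos ⟨⟨by omega, by omega, hs, hsd⟩, by rw [h9]⟩])
    (fun l m' hm' _ hE i s d hl hs hsd => by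
      rw [hval _ _ hm'.1]
      split_ifs
      exacts [le_rfl, hE i s d hl hs hsd])
    (m := m) ⟨hn, fun l hl => absurd (h3 l) hl⟩
  refine ⟨fun t l hl => ?_, fun i s d w => ⟨fun h => ?_, ?_⟩⟩
  · obtain ⟨t', s, d, w, hl, -, ht, -⟩ := h1 _ hl
    rw [(List.cons.inj hl).1]; exact ht
  · obtain ⟨t', s', d', w', hl, -, -, hv⟩ := h1 [((i : ℕ) : ℤ), s, d, w] (by omega)
    simp only [List.cons.injEq, and_true] at hl
    obtain ⟨-, rfl, rfl, rfl⟩ := hl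
    exact hv
  · rintro ⟨hs, hsd, rfl, hd⟩
    have hi := i.isLt
    refine h2 [((i : ℕ) : ℤ), w, d] rfl ?_ i w d rfl hs hsd
    simp only [List.forall_mem_cons, Nat.abs_cast]
    exact ⟨by omega, by omega, hd, by simp⟩

theorem denote_initVertices {m : Memory} (hn : m 0 [] = n) (h4 : ∀ l, m 4 l = 0) :
    (∀ z, 1 ≤ (initVertices.denote n m) 4 [z] → ∃ i : Fin n, z = (i : ℕ)) ∧
    ∀ i : Fin n, 1 ≤ (initVertices.denote n m) 4 [((i : ℕ) : ℤ)] ∧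
      (initVertices.denote n m) 5 [((i : ℕ) : ℤ)] = (i : ℕ) := by
  rw [initVertices]
  generalize hc : Cmd.ite _ _ _ = c
  have hval : ∀ m' : Memory, m' 0 [] = n → ∀ z : ℤ,
      (c.denote n m' 4 [z] = if (0 ≤ m' 9 [] ∧ m' 9 [] < n) ∧ z = m' 9 [] then 1 else m' 4 [z]) ∧
      (c.denote n m' 5 [z] = if (0 ≤ m' 9 [] ∧ m' 9 [] < n) ∧ z = m' 9 [] then m' 9 []
        else m' 5 [z]) := by
    intro m' hm' z
    subst hc
    simp [denote_skip, denote_seq, denote_assign_apply, denote_ite_apply, Test.Holds, Expr.eval,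
      Memory.address, hm', ite_and]
  have hw : ∀ y ∈ [0, 9], c.writes y = false := by subst hc; decide
  obtain ⟨⟨-, h1⟩, h2⟩ := denote_range (n := n) (x := 9) (c := c) (hw 9 (by simp))
    (J := fun m' => m' 0 [] = n ∧ ∀ z, 1 ≤ m' 4 [z] → ∃ i : Fin n, z = (i : ℕ))
    (E := fun z m' => ∀ i : Fin n, z = (i : ℕ) → 1 ≤ m' 4 [((i : ℕ) : ℤ)] ∧
      m' 5 [((i : ℕ) : ℤ)] = (i : ℕ))
    (fun m' z hm' => by
      simp only [Memory.write_of_ne (show (0 : ℕ) ≠ 9 by simp),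
        Memory.write_of_ne (show (4 : ℕ) ≠ 9 by simp)]
      exact hm')
    (fun i m' z hm' => by
      simp only [Memory.write_of_ne (show (5 : ℕ) ≠ 9 by simp),
        Memory.write_of_ne (show (4 : ℕ) ≠ 9 by simp)]
      exact hm')
    (fun m' hm' _ => by
      refine ⟨⟨by rw [denote_of_not_writes (hw 0 (by simp)), hm'.1], fun z hz => ?_⟩,
        fun i hi => ?_⟩
      · rw [(hval m' hm'.1 z).1] at hz
        split_ifs at hz with hif
        · exact ⟨⟨z.toNat, by omega⟩, by simp; omega⟩
        · exact hm'.2 z hz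
      · rw [(hval m' hm'.1 _).1, (hval m' hm'.1 _).2, if_pos ⟨⟨by omega, by omega⟩, hi.symm⟩,
          if_pos ⟨⟨by omega, by omega⟩, hi.symm⟩]
        exact ⟨le_rfl, hi⟩)
    (fun z m' _ hm' _ hE i hi => by
      rw [(hval m' hm'.1 _).1, (hval m' hm'.1 _).2]
      split_ifs with hif
      · exact ⟨le_rfl, hif.2.symm⟩
      · exact hE i hi)
    (m := m) ⟨hn, fun z hz => by rw [h4] at hz; omega⟩
  exact ⟨h1, fun i => h2 (i : ℕ) (by rw [Nat.abs_cast]; omega) i rfl⟩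

theorem invariant_init : Invariant G
    ((Cmd.seq initTables (.seq initVertices (.assign 6 [] (.var 0)))).denote n (graphInput G)) := by
  have i0 : graphInput G 0 [] = n := by simp [graphInput]
  have i1 : ∀ i j : Fin n, graphInput G 1 [((i : ℕ) : ℤ), ((j : ℕ) : ℤ)] = adjEntry G i j := by
    intro i j
    simp only [graphInput, adjEntry]
    rw [if_neg (by simp)]
    classical
    refine if_congr ⟨?_, fun h => ⟨rfl, i, j, h, rfl⟩⟩ rfl rfl
    rintro ⟨-, i', j', h, he⟩
    simp only [List.cons.injEq, Nat.cast_inj, and_true, Fin.val_inj] at he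
    rwa [he.1, he.2]
  have i3 : ∀ l, graphInput G 3 l = 0 := fun l => by simp [graphInput]
  have i4 : ∀ l, graphInput G 4 l = 0 := fun l => by simp [graphInput]
  rw [denote_seq, denote_seq]
  set m₀ := graphInput G
  obtain ⟨ht, hT⟩ := denote_initTables i0 i3
  have e₁ : ∀ y ∈ [0, 1, 4], initTables.denote n m₀ y = m₀ y := fun y hy => by
    have : ∀ y ∈ [0, 1, 4], initTables.writes y = false := by decide
    exact denote_of_not_writes (this y hy) _
  set m₁ := initTables.denote n m₀
  obtain ⟨hV, hP⟩ := denote_initVertices (n := n) (m := m₁) (by rw [e₁ 0 (by simp), i0])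
    (fun l => by rw [e₁ 4 (by simp), i4])
  have e₂ : ∀ y ∈ [0, 1, 3], initVertices.denote n m₁ y = m₁ y := fun y hy => by
    have : ∀ y ∈ [0, 1, 3], initVertices.writes y = false := by decide
    exact denote_of_not_writes (this y hy) _
  set m₂ := initVertices.denote n m₁
  have e₃ : ∀ y, y ≠ 6 → (Cmd.assign 6 [] (.var 0)).denote n m₂ y = m₂ y := fun y hy =>
    denote_of_not_writes (by simpa [writes] using hy) _
  have e6 : (Cmd.assign 6 [] (.var 0)).denote n m₂ 6 [] = n := by
    simp [denote_assign_apply, Expr.eval, Memory.address, e₂ 0, e₁ 0, i0]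
  set m₃ := (Cmd.assign 6 [] (.var 0)).denote n m₂
  have hrem : remaining n m₃ = Finset.univ := by
    ext i; simp [mem_remaining, e₃ 4, (hP i).1]
  have hi : ∀ i : Fin n, ((i : ℕ) : ℤ) < n := fun i => by omega
  refine ⟨?_, ?_, ?_, fun i _ => ?_, fun t l htl => ?_, ?_⟩
  · rw [e₃ 0 (by simp), e₂ 0 (by simp), e₁ 0 (by simp), i0]
  · rw [e₃ 1 (by simp), e₂ 1 (by simp), e₁ 1 (by simp)]; exact i1
  · rw [e₃ 4 (by simp)]; exact hV
  · rw [e₃ 5 (by simp), e6, (hP i).2]; exact hi i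
  · rw [e₃ 3 (by simp), e₂ 3 (by simp)]
    rw [e6] at htl
    by_contra h
    have := ht t l h
    omega
  · rw [hrem]
    convert represents_univ G using 1
    funext i s d w
    rw [Fintype.card_fin, ← hT i s d w, tableConstraint, e₃ 3 (by simp), e₂ 3 (by simp),
      e₃ 5 (by simp), (hP i).2]

/-- With one vertex left the incoming sum is empty, so only entries with `d = 0` count. The size
bound places every relevant entry within reach of the loops. -/
theorem Invariant.output_findMinimum {m : Memory} (h : Invariant G m)
    (hcard : (remaining n m).card ≤ 1) :
    output (findMinimum.denote n m) = minusDominationNumber G := by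
  rw [output, findMinimum, denote_seq, denote_seq]
  generalize hc : Cmd.ite _ _ _ = c
  set m₀ := (Cmd.assign 25 [] (.const 0)).denote n ((Cmd.assign 2 [] (.var 0)).denote n m) with hm₀
  have e₀ : ∀ y, y ≠ 2 → y ≠ 25 → m₀ y = m y := fun y h2 h25 => by
    rw [hm₀, denote_of_not_writes (by simpa [writes] using h25),
      denote_of_not_writes (by simpa [writes] using h2)]
  have e2 : m₀ 2 [] = n := by
    simp [hm₀, denote_assign_apply, Expr.eval, Memory.address, h.size]
  -- Array indices have to be variables, so the index `0` needs one of its own.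
  have e25 : m₀ 25 [] = 0 := by
    simp [hm₀, denote_assign_apply, Expr.eval]
  have hval : ∀ m' : Memory, (∀ y ∈ [3, 4, 5, 25], m' y = m₀ y) → c.denote n m' 2 [] =
      if 1 ≤ m 4 [m' 9 []] ∧ 1 ≤ m 3 [m 5 [m' 9 []], m' 11 [], 0, m' 14 []] ∧ m' 14 [] ≤ m' 2 []
        then m' 14 [] else m' 2 [] := by
    intro m' hm'
    simp only [List.forall_mem_cons] at hm'
    obtain ⟨h3, h4, h5, h25, -⟩ := hm'
    subst hc
    simp [denote_skip, denote_seq, denote_assign_apply, denote_ite_apply, Test.Holds, Expr.eval,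
      Memory.address, h3, h4, h5, h25, e25, e₀, ite_and]
  have hw : ∀ y ∈ [3, 4, 5, 25, 9, 11, 14], c.writes y = false := by subst hc; decide
  obtain ⟨⟨-, h1⟩, h2⟩ := denote_ranges (n := n) (xs := [9, 11, 14]) (c := c) (by decide)
    (fun x hx => hw x (by simp at hx ⊢; tauto))
    (J := fun m' => (∀ y ∈ [3, 4, 5, 25], m' y = m₀ y) ∧ (m' 2 [] = n ∨
      ∃ i ∈ remaining n m, ∃ s, tableConstraint m i s 0 (m' 2 [])))
    (E := fun l m' => ∀ i ∈ remaining n m, ∀ s w, l = [((i : ℕ) : ℤ), s, w] →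
      tableConstraint m i s 0 w → m' 2 [] ≤ w)
    (fun x hx m' z hm' => by
      simp only [Memory.write_of_ne (show (2 : ℕ) ≠ x by rintro rfl; simp at hx)]
      refine ⟨fun y hy => ?_, hm'.2⟩
      rw [← hm'.1 y hy]; funext a
      refine Memory.write_of_ne ?_ _ _ _
      rintro rfl; simp at hx hy; omega)
    (fun x hx l m' z hm' => by
      simp only [Memory.write_of_ne (show (2 : ℕ) ≠ x by rintro rfl; simp at hx)]
      exact hm')
    (fun m' hm' _ => by
      refine ⟨⟨fun y hy => ?_, ?_⟩, fun i hi s w hl ht => ?_⟩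
      · rw [denote_of_not_writes (hw y (by simp at hy ⊢; tauto)), hm'.1 y hy]
      · rw [hval m' hm'.1]
        split_ifs with hif
        · obtain ⟨h4, h3, -⟩ := hif
          obtain ⟨i, hi⟩ := h.vertex _ h4
          rw [hi] at h3 h4
          exact Or.inr ⟨i, mem_remaining.2 h4, _, h3⟩
        · exact hm'.2
      · simp only [List.map_cons, List.map_nil, List.cons.injEq, and_true] at hl
        obtain ⟨h9, rfl, rfl⟩ := hl
        rw [hval m' hm'.1]
        split_ifs with hif
        · exact le_rfl
        · rw [h9] at hif
          by_contra hlt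
          exact hif ⟨mem_remaining.1 hi, ht, (not_le.1 hlt).le⟩)
    (fun l m' hm' _ hE i hi s w hl ht => by
      have := hE i hi s w hl ht
      rw [hval m' hm'.1]
      split_ifs with hif
      exacts [hif.2.2.trans this, this])
    (m := m₀) ⟨fun _ _ => rfl, Or.inl e2⟩
  set z := (ranges [9, 11, 14] c).denote n m₀ 2 []
  obtain ⟨hne, ⟨size, hpos, hsum, hsize⟩, hW⟩ := h.represents
  have hleast := isLeast_minusDominationNumber G
  refine IsLeast.unique ?_ hleast
  rw [← hW] at hleast ⊢
  rw [Fintype.card_fin] at hsum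
  rcases Nat.le_one_iff_eq_zero_or_eq_one.1 hcard with h0 | h0
  · rw [Finset.card_eq_zero] at h0
    -- Merging never empties a nonempty graph, which is the first clause of `Represents`.
    have hn : n = 0 := by
      by_contra hn
      have : Nonempty (Fin n) := ⟨⟨0, Nat.pos_of_ne_zero hn⟩⟩
      exact (hne this).ne_empty h0
    have hz : z = 0 := by
      rcases h1 with h1 | ⟨i, hi, -⟩
      · rw [h1, hn]; rfl
      · simp [h0] at hi
    rw [hz, h0]
    refine ⟨⟨fun _ => 0, fun _ => 0, by simp, by simp⟩, ?_⟩
    rintro W ⟨s, w, -, rfl⟩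
    simp
  · obtain ⟨v, hv⟩ := Finset.card_eq_one.1 h0
    rw [hv, Finset.sum_singleton] at hsum
    have hmem : ∀ W, W ∈ constrainedWeights G (remaining n m) (tableConstraint m) ↔
        ∃ s, tableConstraint m v s 0 W := by
      intro W
      rw [hv]
      constructor
      · rintro ⟨s, w, h, rfl⟩
        have := h v (Finset.mem_singleton_self v)
        rw [Finset.sum_singleton, adjEntry_self, zero_mul] at this
        rw [Finset.sum_singleton]
        exact ⟨_, this⟩
      · rintro ⟨s, h⟩
        refine ⟨fun _ => s, fun _ => W, fun i hi => ?_, by simp⟩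
        rw [Finset.mem_singleton.1 hi, Finset.sum_singleton, adjEntry_self, zero_mul]
        exact h
    have hvm : v ∈ remaining n m := by rw [hv]; exact Finset.mem_singleton_self v
    have hlow : ∀ s W, tableConstraint m v s 0 W → z ≤ W ∧ W ≤ n := by
      intro s W hsW
      have hb := hsize v hvm s 0 W hsW
      have hvn := v.isLt
      refine ⟨h2 [((v : ℕ) : ℤ), s, W] rfl ?_ v hvm s W rfl hsW,
        (le_abs_self W).trans (hb.2.trans hsum)⟩
      simp only [List.forall_mem_cons, Nat.abs_cast]
      exact ⟨by omega, hb.1.trans hsum, hb.2.trans hsum, by simp⟩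
    refine ⟨(hmem z).2 ?_, fun W hW' => ?_⟩
    · rcases h1 with h1 | ⟨i, hi, s, h1⟩
      -- The output may still be the default `n`. The minimum is attained by an entry that is at
      -- least the output and at most `n`, so the default is correct.
      · obtain ⟨s, hs⟩ := (hmem _).1 hleast.1
        have := hlow _ _ hs
        rw [← h1] at this
        exact ⟨s, (le_antisymm this.1 this.2) ▸ hs⟩
      · rw [hv, Finset.mem_singleton] at hi
        exact ⟨s, hi ▸ h1⟩
    · obtain ⟨s, hs⟩ := (hmem W).1 hW'
      exact (hlow s W hs).1

end Algorithm

end MinusDomination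

theorem mainTheorem7 :
    ∃ p : MinusDomination.Program,
      MinusDomination.ComputesInPolyTime p
        (fun {_n} G => MinusDomination.IsDistanceHereditary G)
        (fun {_n} G => MinusDomination.minusDominationNumber G) := by
  refine ⟨MinusDomination.algorithm.compile, MinusDomination.algorithm.cost, fun n G hG => ?_⟩
  obtain ⟨t, ht, hrun⟩ := MinusDomination.Cmd.runs_compile (n := n)
    MinusDomination.wellFormed_algorithm (m := MinusDomination.graphInput G)
    (by simp [MinusDomination.graphInput])
  obtain ⟨hI, hcard⟩ := (MinusDomination.invariant_init (G := G)).denote_mainLoop hG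
  exact ⟨_, t, hrun, ht, hI.output_findMinimum hcard⟩
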